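/- Let $A$ be a commutative ring. **Conventions.** For an ideal $\mathfrak a=\langle a_1,\dots,a_n\rangle$, $\mathrm{Gr}(\mathfrak a)\ge k$ means that the Kronecker sequence of the $k$ linear forms $\sum_i a_iX_{j,i}$ ($1\le j\le k$), in disjoint sets of variables, is a regular sequence in $A[(X_{j,i})]$ (each term is a nonzerodivisor modulo the preceding ones; the last quotient may be zero). This does not depend on the generators. $\mathcal D_p(B)$ is the ideal generated by the $p\times p$ minors of a matrix $B$ (with $\mathcal D_0(B)=\langle1\rangle$), and $\mathcal F_k(M)=\mathcal D_{n-k}(B)$ is the $k$-th Fitting ideal of $M=\mathrm{Coker}(B)$, $B\in A^{n\times l}$. A *strong gcd* of a faithful ideal $\mathfrak a$ is an element $g$ dividing all elements of $\mathfrak a$ and such that, for every nonzerodivisor $y$ and every $x\in A$, if $y$ divides $xb$ for all $b\in\mathfrak a$ then $y$ divides $xg$. For a nonzerodivisor $g$ with $\mathfrak a\subseteq\langle g\rangle$, $\mathfrak a/g$ denotes the ideal with $g\,(\mathfrak a/g)=\mathfrak a$. A *MacRae module* is a finitely presented module $M$ for which there is a nonzerodivisor $e$ with $\mathcal F_0(M)\subseteq\langle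 e\rangle$ and $\mathrm{Gr}(\mathcal F_0(M)/e)\ge2$; the ideal $\langle e\rangle$, which depends only on $M$, is its *MacRae invariant*. The module $\bigwedge^pA^n$ has its natural basis $(e_I)$, $I\subseteq\{1,\dots,n\}$, $|I|=p$; $\mathcal D_1(x)$ is the ideal generated by the coordinates of a vector $x$. For $x\in\bigwedge^nA^n$ write $x=[x]\,e_1\wedge\cdots\wedge e_n$. For $p+q=n$ the Hodge isomorphism $\bigwedge^pA^n\to\bigwedge^qA^n$ is $x\mapsto x^*=\sum_{|J|=q}[x\wedge e_J]\,e_J$. **Data.** Let $(r_k)_{k\ge0}$ be natural numbers with $r_k=0$ for $k>m$, and let $$L_\bullet:\quad 0\to L_m\xrightarrow{A_m}L_{m-1}\to\cdots\to L_1\xrightarrow{A_1}L_0,\qquad L_k=A^{r_{k+1}+r_k},$$ be a complex ($L_k=0$ for $k>m$), so that its Euler characteristic is $\chi(L_\bullet)=r_0$. Put $\mathfrak D_k=\mathcal D_{r_k}(A_k)$ for $k\ge1$ and $M=\mathrm{Coker}(A_1)$. Assume that $L_\bullet$ is a *Cayley complex*: $\mathrm{Gr}(\mathfrak D_1)\ge1$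 and $\mathrm{Gr}(\mathfrak D_k)\ge2$ for $2\le k\le m$. **Theorem.** 1. There is a unique system of vectors $u_k\in\bigwedge^{r_{k+1}}L_k$ ($0\le k\le m$) with $u_m=1$ and, as matrices on the natural bases, $$\textstyle\bigwedge^{r_k}A_k=u_{k-1}\cdot{}^{t}(u_k^*)\qquad(1\le k\le m).$$ Put $\mathfrak B_k=\mathcal D_1(u_k)$ (the *factorization ideals*; $u_k=1$, $\mathfrak B_k=\langle1\rangle$ for $k>m$). Then $\mathfrak D_k=\mathfrak B_k\mathfrak B_{k-1}$ for $k\ge1$. 2. $\mathrm{Gr}(\mathfrak B_0)\ge1$, $\mathrm{Gr}(\mathfrak B_k)\ge2$ for $k\ge1$, and $$\prod_{k=0}^{m}\mathfrak B_k=\mathfrak B_0\prod_{1<2k\le m}\mathfrak D_{2k}=\prod_{1\le2k+1\le m}\mathfrak D_{2k+1}.$$ 3. Suppose $\chi(L_\bullet)=r_0=0$, so that $L_0=A^{r_1}$ and $u_0$ has a single coordinate $\mathfrak g$, the *Cayley determinant*; thus $\mathfrak B_0=\langle\mathfrak g\rangle$. Then $\bigwedge^{r_1}A_1=\mathfrak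 g\cdot{}^{t}(u_1^*)$; $\mathfrak g$ is a nonzerodivisor; $\mathfrak D_1=\mathcal F_0(M)$; $\mathfrak g$ is a strong gcd of this ideal; $\mathrm{Gr}(\mathfrak D_1/\mathfrak g)\ge2$; and $M$ is a MacRae module whose MacRae invariant is $\mathfrak B_0=\langle\mathfrak g\rangle$. 4. If $\chi(L_\bullet)=r_0>0$ and $\mathfrak B_0=\langle g\rangle$, then $g$ is a nonzerodivisor, $\mathfrak D_1=\mathcal F_{r_0}(M)$, $g$ is a strong gcd of this ideal, and $\mathrm{Gr}(\mathfrak D_1/g)\ge2$. 5. (Changes of bases.) Let $P_k\in\mathrm{GL}(L_k)$ and let $L'_\bullet$ be the complex with the same modules and with matrices $A'_k=P_{k-1}^{-1}A_kP_k$. Then $L'_\bullet$ is a Cayley complex with the same ideals $\mathfrak D_k$ and $\mathfrak B_k$. Its vectors $u'_k$ are obtained from the $u_k$ by multiplication on the left by invertible matrices, namely by unit multiples of $\bigwedge^{r_{k+1}}P_k^{-1}$. If $r_0=0$, the Cayley determinant is multiplied by a unit. 6. (Elementary modifications.) For $k,s\ge0$ and $E=A^s$, the elementary modification of $L_\bullet$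 at $k$ by $E$ is the direct sum of $L_\bullet$ and of the complex $E\xrightarrow{\mathrm{id}}E$ placed in degrees $k+1$ and $k$; its expected ranks are the $r_j$, except that $r_{k+1}$ is replaced by $r_{k+1}+s$. If a complex of the above form is obtained from $L_\bullet$ by a finite number of changes of bases and of elementary modifications or their inverses, then it is a Cayley complex with the same ideals $\mathfrak D_k$ and $\mathfrak B_k$ (for all $k$) as $L_\bullet$. -/

import Mathlib

/-! ## Depth of a finitely generated ideal -/

/-- The Kronecker sequence of length `k` attached to `a₁, …, aₙ`: the `k` linear forms
`∑ i, aᵢ X_{j,i}` (`j = 1, …, k`), in pairwise disjoint sets of variables. -/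
noncomputable def kroneckerSeq {R : Type*} [CommRing R] (k : ℕ) {n : ℕ} (a : Fin n → R) :
    List (MvPolynomial (Fin k × Fin n) R) :=
  List.ofFn fun j : Fin k => ∑ i, MvPolynomial.C (a i) * MvPolynomial.X (j, i)

/-- `Gr(I) ≥ k` (true grade, or depth, in the sense of Hochster and Northcott): `I` is finitely
generated and a Kronecker sequence of length `k` attached to `I` is regular (each term is a
nonzerodivisor modulo the preceding ones; the last quotient may be zero). -/
def DepthGE {R : Type*} [CommRing R] (k : ℕ) (I : Ideal R) : Prop :=
  ∃ (n : ℕ) (a : Fin n → R), Ideal.span (Set.range a) = I ∧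
    RingTheory.Sequence.IsWeaklyRegular (MvPolynomial (Fin k × Fin n) R) (kroneckerSeq k a)

/-! ## Determinantal ideals, Fitting ideals, strong gcd, MacRae modules -/

/-- The determinantal ideal `𝒟_p(A)`, generated by the minors of order `p` of `A`. -/
def detIdeal {R : Type*} [CommRing R] {a b : ℕ} (p : ℕ) (A : Matrix (Fin a) (Fin b) R) :
    Ideal R :=
  Ideal.span {d | ∃ (f : Fin p → Fin a) (g : Fin p → Fin b), d = (A.submatrix f g).det}

/-- The Fitting ideal `ℱ_k(M)` of a finitely presented module: `𝒟_{n-k}(A)` for a presentation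
`Rˡ → Rⁿ → M → 0` with matrix `A`. All presentations give the same ideal, so that taking the
supremum over all of them is only a way of not choosing one. (For `n ≤ k` this is `⟨1⟩`.) -/
def fittingIdeal (R : Type*) [CommRing R] (M : Type*) [AddCommGroup M] [Module R M] (k : ℕ) :
    Ideal R :=
  ⨆ (n : ℕ) (l : ℕ) (A : Matrix (Fin n) (Fin l) R)
    (_ : Nonempty (M ≃ₗ[R] ((Fin n → R) ⧸ LinearMap.range A.mulVecLin))), detIdeal (n - k) A

/-- `g` is a strong gcd of the (faithful) ideal `I`: it divides every element of `I`, and for all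
`x` and all nonzerodivisors `y`, if `y` divides `x b` for every `b ∈ I`, then `y` divides `x g`. -/
def IsStrongGcd {R : Type*} [CommRing R] (g : R) (I : Ideal R) : Prop :=
  (∀ x : R, (∀ b ∈ I, b * x = 0) → x = 0) ∧
  (∀ b ∈ I, g ∣ b) ∧
  ∀ y ∈ nonZeroDivisors R, ∀ x : R, (∀ b ∈ I, y ∣ x * b) → y ∣ x * g

/-- The ideal `I / g = {x | g x ∈ I}`; for a nonzerodivisor `g` with `I ⊆ ⟨g⟩` this is the ideal
with `I = g (I / g)`. -/
def Ideal.quotBy {R : Type*} [CommRing R] (I : Ideal R) (g : R) : Ideal R :=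
  Submodule.comap (LinearMap.mulLeft R g) I

/-- `e` is a nonzerodivisor with `I ⊆ ⟨e⟩` and `Gr(I / e) ≥ 2`. -/
def IsMacRaeGenerator {R : Type*} [CommRing R] (I : Ideal R) (e : R) : Prop :=
  e ∈ nonZeroDivisors R ∧ I ≤ Ideal.span {e} ∧ DepthGE 2 (I.quotBy e)

/-- A MacRae module: finitely presented, and `ℱ₀(M)` is a MacRae ideal. -/
def IsMacRaeModule (R : Type*) [CommRing R] (M : Type*) [AddCommGroup M] [Module R M] : Prop :=
  Module.FinitePresentation R M ∧ ∃ e : R, IsMacRaeGenerator (fittingIdeal R M 0) e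

open Classical in
/-- The MacRae invariant of a MacRae module `M`: the ideal `⟨e⟩`, where `e` is a nonzerodivisor
with `ℱ₀(M) ⊆ ⟨e⟩` and `Gr(ℱ₀(M) / e) ≥ 2` (the ideal does not depend on `e`). -/
noncomputable def macRaeInvariant (R : Type*) [CommRing R] (M : Type*) [AddCommGroup M]
    [Module R M] : Ideal R :=
  if h : ∃ e : R, IsMacRaeGenerator (fittingIdeal R M 0) e then Ideal.span {h.choose} else ⊤

/-! ## Exterior powers of `Rⁿ` in natural bases, and the Hodge isomorphism -/

/-- The natural basis `(e_I)` of `⋀ᵖ Rⁿ`, indexed by the subsets `I` of `Fin n` of cardinality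
`p`, where `e_I` is the product of the `e_i`, `i ∈ I`, in increasing order. -/
noncomputable def natBasis (R : Type*) [CommRing R] (n p : ℕ) :
    Module.Basis (Set.powersetCard (Fin n) p) R (⋀[R]^p (Fin n → R)) :=
  (Pi.basisFun R (Fin n)).exteriorPower p

/-- The column of coordinates of `x ∈ ⋀ᵖ Rⁿ` on the natural basis. -/
noncomputable def coords {R : Type*} [CommRing R] {n p : ℕ} (x : ⋀[R]^p (Fin n → R)) :
    Set.powersetCard (Fin n) p → R :=
  fun I => (natBasis R n p).repr x I

/-- The ideal `𝒟₁(x)` generated by the coordinates of `x`. -/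
noncomputable def coordIdeal {R : Type*} [CommRing R] {n p : ℕ} (x : ⋀[R]^p (Fin n → R)) :
    Ideal R :=
  Ideal.span (Set.range (coords x))

/-- The matrix of `⋀ᵖ A` on the natural bases. -/
noncomputable def extMatrix {R : Type*} [CommRing R] {a b : ℕ} (p : ℕ)
    (A : Matrix (Fin a) (Fin b) R) :
    Matrix (Set.powersetCard (Fin a) p) (Set.powersetCard (Fin b) p) R :=
  LinearMap.toMatrix (natBasis R b p) (natBasis R a p) (exteriorPower.map p (Matrix.toLin' A))

/-- The exterior product `⋀ᵖ M × ⋀^q M → ⋀^(p+q) M`. -/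
def wedge {R : Type*} [CommRing R] {M : Type*} [AddCommGroup M] [Module R M] {p q : ℕ}
    (x : ⋀[R]^p M) (y : ⋀[R]^q M) : ⋀[R]^(p + q) M :=
  ⟨(x : ExteriorAlgebra R M) * (y : ExteriorAlgebra R M),
    SetLike.mul_mem_graded x.2 y.2⟩

/-- The coefficient `[x]` in `x = [x] e₁ ∧ ⋯ ∧ eₙ`, for `x ∈ ⋀ⁿ Rⁿ`. -/
noncomputable def topCoeff {R : Type*} [CommRing R] {n : ℕ} (x : ⋀[R]^n (Fin n → R)) : R :=
  coords x ⟨Finset.univ, by simp⟩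

/-- The (right) Hodge isomorphism `⋀ᵖ Rⁿ → ⋀^q Rⁿ`, `n = p + q`: `x ↦ ∑_J [x ∧ e_J] e_J`. -/
noncomputable def hodge {R : Type*} [CommRing R] {p q : ℕ} (x : ⋀[R]^p (Fin (p + q) → R)) :
    ⋀[R]^q (Fin (p + q) → R) :=
  ∑ J, topCoeff (wedge x (natBasis R (p + q) q J)) • natBasis R (p + q) q J

/-! ## Bounded complexes of finite free modules with expected ranks -/

/-- A bounded complex of finite free modules `L_k = R^{r_{k+1} + r_k}`, `k ≥ 0`, with `r_k = 0`
for all large `k`. The matrix of the differential `L_{k+1} → L_k`, usually written `A_{k+1}`,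
is `A k`. -/
structure FreeComplex (R : Type*) [CommRing R] where
  r : ℕ → ℕ
  bounded : ∃ m, ∀ k, m < k → r k = 0
  A : ∀ k, Matrix (Fin (r (k + 1) + r k)) (Fin (r (k + 2) + r (k + 1))) R
  comp : ∀ k, A k * A (k + 1) = 0

namespace FreeComplex

variable {R : Type*} [CommRing R]

/-- The rank of `L_k`. -/
abbrev dim (C : FreeComplex R) (k : ℕ) : ℕ := C.r (k + 1) + C.r k

/-- The characteristic ideal `𝔇_{k+1} = 𝒟_{r_{k+1}}(A_{k+1})`, `A_{k+1} : L_{k+1} → L_k`. -/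
def charIdeal (C : FreeComplex R) (k : ℕ) : Ideal R := detIdeal (C.r (k + 1)) (C.A k)

/-- A Cayley complex: `Gr(𝔇₁) ≥ 1` and `Gr(𝔇_k) ≥ 2` for `k ≥ 2`. (The condition is automatic
when `k` exceeds the length of the complex, since then `𝔇_k = ⟨1⟩`.) -/
def IsCayley (C : FreeComplex R) : Prop :=
  DepthGE 1 (C.charIdeal 0) ∧ ∀ k, 1 ≤ k → DepthGE 2 (C.charIdeal k)

/-- The module `M = Coker A₁`. -/
abbrev Coker (C : FreeComplex R) : Type _ :=
  (Fin (C.dim 0) → R) ⧸ LinearMap.range (C.A 0).mulVecLin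

/-- Systems of vectors `u_k ∈ ⋀^{r_{k+1}} L_k`. -/
abbrev VectorSystem (C : FreeComplex R) : Type _ :=
  ∀ k, ⋀[R]^(C.r (k + 1)) (Fin (C.dim k) → R)

/-- `(u_k)` is the system of factorization vectors of the complex: `u_k = 1` when `r_j = 0` for
all `j > k` (in particular `u_m = 1` for a complex `0 → L_m → ⋯ → L_0`), and
`⋀^{r_{k+1}} A_{k+1} = u_k · ᵗ(u_{k+1}*)` as matrices on the natural bases. -/
def IsFactorization (C : FreeComplex R) (u : C.VectorSystem) : Prop :=
  (∀ k, (∀ j, k < j → C.r j = 0) → (u k : ExteriorAlgebra R (Fin (C.dim k) → R)) = 1) ∧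
  ∀ k, extMatrix (C.r (k + 1)) (C.A k) =
    Matrix.vecMulVec (coords (u k)) (coords (hodge (u (k + 1))))

/-- The factorization ideal `𝔅_k = 𝒟₁(u_k)`. -/
noncomputable def factIdeal (C : FreeComplex R) (u : C.VectorSystem) (k : ℕ) : Ideal R :=
  coordIdeal (u k)

/-- The Cayley determinant, when `r₀ = 0`: the single coefficient of
`u₀ ∈ ⋀^{r₁} L₀ = ⋀^{r₁} R^{r₁}`. -/
noncomputable def cayleyDet (C : FreeComplex R) (h : C.r 0 = 0) (u : C.VectorSystem) : R :=
  coords (u 0) ⟨Finset.univ, by simp [h]⟩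

/-- Change of bases: `P k` is the matrix of the new basis of `L_k` on the old one. -/
def changeBasis (C : FreeComplex R) (P : ∀ k, GL (Fin (C.dim k)) R) : FreeComplex R where
  r := C.r
  bounded := C.bounded
  A k := ((P k)⁻¹ : GL (Fin (C.dim k)) R).val * C.A k * (P (k + 1)).val
  comp k := by
    have h : (P (k + 1)).val * ((P (k + 1))⁻¹ : GL (Fin (C.dim (k + 1))) R).val = 1 := by
      rw [← Units.val_mul, mul_inv_cancel, Units.val_one]
    calc _ = ((P k)⁻¹ : GL (Fin (C.dim k)) R).val * C.A k *
          ((P (k + 1)).val * ((P (k + 1))⁻¹ : GL (Fin (C.dim (k + 1))) R).val) *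
            (C.A (k + 1) * (P (k + 2)).val) := by simp only [Matrix.mul_assoc]
      _ = ((P k)⁻¹ : GL (Fin (C.dim k)) R).val * (C.A k * C.A (k + 1)) * (P (k + 2)).val := by
          rw [h, Matrix.mul_one]; simp only [Matrix.mul_assoc]
      _ = 0 := by rw [C.comp]; simp

/-- The expected ranks after the elementary modification at `k` by `E = Rˢ`. -/
def modRank (C : FreeComplex R) (k s : ℕ) : ℕ → ℕ :=
  Function.update C.r (k + 1) (C.r (k + 1) + s)

/-- The differentials after the elementary modification at `k` by `E = Rˢ`. With the basis of `E`
placed after those of `L_k` and of `L_{k+1}`, the differential `L_{k+1} × E → L_k × E` is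
block diagonal with blocks `A_{k+1}` and the identity of `E`, while the differential into
`L_{k+1} × E` is extended by zero rows and the one out of `L_k × E` by zero columns. -/
def modMatrix (C : FreeComplex R) (k s j : ℕ) :
    Matrix (Fin (C.modRank k s (j + 1) + C.modRank k s j))
      (Fin (C.modRank k s (j + 2) + C.modRank k s (j + 1))) R :=
  Matrix.of fun p q =>
    if h : p.val < C.dim j ∧ q.val < C.dim (j + 1) then C.A j ⟨p.val, h.1⟩ ⟨q.val, h.2⟩
    else if j = k ∧ C.dim k ≤ p.val ∧ C.dim (k + 1) ≤ q.val ∧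
        p.val - C.dim k = q.val - C.dim (k + 1) then 1
    else 0

/-- The elementary modification of the complex at `k` by `E = Rˢ`: the complex `E → E` (identity
map), in degrees `k + 1` and `k`, is added as a direct summand. -/
def elemMod (C : FreeComplex R) (k s : ℕ) : FreeComplex R where
  r := C.modRank k s
  bounded := by
    obtain ⟨m, hm⟩ := C.bounded
    refine ⟨max m (k + 1), fun j hj => ?_⟩
    rw [max_lt_iff] at hj
    rw [modRank, Function.update_of_ne (by omega)]
    exact hm j hj.1
  A := C.modMatrix k s
  comp j := by
    have hle : ∀ i, C.dim i ≤ C.modRank k s (i + 1) + C.modRank k s i := by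
      intro i
      simp only [dim, modRank, Function.update_apply]
      split_ifs <;> simp_all
    ext p t
    rw [Matrix.mul_apply, Matrix.zero_apply]
    by_cases hpt : p.val < C.dim j ∧ t.val < C.dim (j + 2)
    · have h0 := congrFun (congrFun (C.comp j) ⟨p.val, hpt.1⟩) ⟨t.val, hpt.2⟩
      rw [Matrix.mul_apply, Matrix.zero_apply] at h0
      rw [← h0]
      symm
      refine Fintype.sum_of_injective (Fin.castLE (hle (j + 1))) (Fin.castLE_injective _) _ _ ?_ ?_
      · intro q hq
        have hq' : ¬ q.val < C.dim (j + 1) := fun h => hq ⟨⟨q.val, h⟩, rfl⟩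
        have h2 : ¬ (j = k ∧ C.dim k ≤ p.val ∧ C.dim (k + 1) ≤ q.val ∧
            p.val - C.dim k = q.val - C.dim (k + 1)) := by
          rintro ⟨rfl, h, -⟩
          omega
        simp only [modMatrix, Matrix.of_apply]
        rw [dif_neg (fun h => hq' h.2), if_neg h2, zero_mul]
      · intro q
        have hq : (Fin.castLE (hle (j + 1)) q).val < C.dim (j + 1) := q.isLt
        simp only [modMatrix, Matrix.of_apply]
        rw [dif_pos ⟨hpt.1, hq⟩, dif_pos ⟨hq, hpt.2⟩]
        rfl
    · refine Finset.sum_eq_zero fun q _ => ?_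
      simp only [modMatrix, Matrix.of_apply]
      split_ifs with h1 h2 h3 h4 h5 h6
      · exact absurd ⟨h1.1, h2.2⟩ hpt
      · obtain ⟨rfl, h, -⟩ := h3
        exact absurd h1.2 (not_lt.mpr h)
      · rw [mul_zero]
      · obtain ⟨rfl, -, h, -⟩ := h4
        exact absurd h5.1 (not_lt.mpr h)
      · omega
      · rw [mul_zero]
      · rw [zero_mul]
      · rw [zero_mul]
      · rw [zero_mul]

/-- Elementary equivalence: `C'` is obtained from `C` by finitely many changes of bases and
elementary modifications, where a modification may add or remove a summand `E → E`. -/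
inductive ElemEquiv : FreeComplex R → FreeComplex R → Prop
  | changeBasis (C : FreeComplex R) (P : ∀ k, GL (Fin (C.dim k)) R) :
      ElemEquiv C (C.changeBasis P)
  | elemMod (C : FreeComplex R) (k s : ℕ) : ElemEquiv C (C.elemMod k s)
  | refl (C : FreeComplex R) : ElemEquiv C C
  | symm {C C' : FreeComplex R} : ElemEquiv C C' → ElemEquiv C' C
  | trans {C C' C'' : FreeComplex R} : ElemEquiv C C' → ElemEquiv C' C'' → ElemEquiv C C''

end FreeComplex

/-! ## Linear forms and McCoy's theorem -/

/-! Grade is first freed from polynomial rings. By McCoy's theorem, grade at least one means that a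
finitely generated ideal is faithful. Grade at least two means that, in addition, every family
proportional to the elements of the ideal is a multiple of them (`depthGE_one_iff`,
`depthGE_two_iff`). Both conditions pass to larger finitely generated ideals, so an equality
`𝔇_{k+1} = 𝔅_{k+1} 𝔅_k` transfers grade from the characteristic ideals to the factorization ideals.

The factorization is built downwards from the top degree. Let `⋀A_{k+1} = u_k · ᵗ(u_{k+1}*)` be
known. Since `A_k A_{k+1} = 0`, a block triangular determinant (`det_mul_topPairing_map`) shows that
every row of `⋀^{r_k} A_k`, multiplied by any coordinate of `u_k`, is a multiple of `u_k*`. As `𝔅_k`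
is faithful, the rows are proportional to `u_k*`; as it has grade two, they are multiples of `u_k*`.
The multipliers are the coordinates of `u_{k-1}` (`exists_forall_map_eq_topPairing_smul`).
Faithfulness of `𝔅_k` also gives uniqueness. Throughout, the Hodge isomorphism is replaced by the
pairing `[x ∧ y]`, and `𝔅_k` is the set of values of `[u_k ∧ ·]`.

When `𝔅₀ = ⟨g⟩`, one has `𝔇₁ = 𝔅₁ g` with `𝔅₁` of grade two. This gives the strong gcd and, for `r₀
= 0`, the MacRae invariant; `𝔇₁` is a Fitting ideal because Fitting ideals do not depend on the
presentation.

For invariance, the characteristic ideals are compared directly on minors, so the Cayley property is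
preserved. Transporting the vectors down the complex and cancelling by faithfulness shows that a
change of bases acts on `u_k` by a unit times `⋀P_k⁻¹`, and that an elementary modification at `k`
wedges `u_k` with the basis of `E`, up to a unit. -/

open MvPolynomial in
/-- McCoy's theorem for a generic linear form. -/
theorem MvPolynomial.eq_zero_of_linearForm_mul_eq_zero {R : Type*} [CommRing R] {n : ℕ}
    {a : Fin n → R} (ha : ∀ x, (∀ i, a i * x = 0) → x = 0) (g : MvPolynomial (Fin n) R)
    (h : (∑ i, C (a i) * X i) * g = 0) : g = 0 := by
  classical
  induction hk : g.support.card using Nat.strong_induction_on generalizing g with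
  | _ k ih =>
  subst hk
  by_contra hg
  -- Look at the coefficient of `X^d X_i` in the product, with `d` the lexicographically largest
  -- exponent of `g`. Terms `j < i` vanish by minimality of `i`; terms `j > i` would need an
  -- exponent of `g` above `d`. So `a i` kills the coefficient at `d`, and `C (a i) * g` has smaller
  -- support.
  obtain ⟨i, hi, hmin⟩ : ∃ i, C (a i) * g ≠ 0 ∧ ∀ j < i, C (a j) * g = 0 := by
    have hex : ∃ i, C (a i) * g ≠ 0 := by
      by_contra! hall
      refine hg (MvPolynomial.ext _ _ fun m => ha _ fun i => ?_)
      rw [← coeff_C_mul, hall i, coeff_zero]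
    obtain ⟨i, hi, hm⟩ := WellFounded.has_min (wellFounded_lt (α := Fin n))
      {i | C (a i) * g ≠ 0} hex
    exact ⟨i, hi, fun j hj => by_contra fun hne => hm j hne hj⟩
  obtain ⟨d, hd, hmax⟩ := Finset.exists_max_image g.support toLex (support_nonempty.mpr hg)
  have hcoeff : a i * coeff d g = 0 := by
    have h0 := congrArg (coeff (d + Finsupp.single i 1)) h
    rw [Finset.sum_mul, coeff_sum, coeff_zero] at h0
    rw [← h0, Finset.sum_eq_single i]
    · rw [mul_assoc, coeff_C_mul, coeff_X_mul', if_pos (by simp), add_tsub_cancel_right]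
    · intro j _ hji
      rcases lt_or_gt_of_ne hji with hlt | hgt
      · rw [mul_right_comm, hmin j hlt, zero_mul, coeff_zero]
      · rw [mul_assoc, coeff_C_mul, coeff_X_mul']
        split_ifs with hj
        · have : coeff (d + Finsupp.single i 1 - Finsupp.single j 1) g = 0 := by
            by_contra hne
            refine absurd (hmax _ (mem_support_iff.mpr hne)) (not_le.mpr ?_)
            rw [Finsupp.Lex.lt_iff]
            refine ⟨i, fun l hl => ?_, ?_⟩
            · have h1 : i ≠ l := hl.ne'
              have h2 : j ≠ l := (hl.trans hgt).ne'
              simp [h1, h2]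
            · simp [hji]
          rw [this, mul_zero]
        · rw [mul_zero]
    · simp
  refine hi (ih _ (Finset.card_lt_card ?_) (C (a i) * g) ?_ rfl)
  · refine (Finset.ssubset_iff_of_subset fun m hm => ?_).mpr ⟨d, hd, ?_⟩
    · rw [mem_support_iff, coeff_C_mul] at hm
      exact mem_support_iff.mpr (right_ne_zero_of_mul hm)
    · rw [notMem_support_iff, coeff_C_mul, hcoeff]
  · rw [mul_left_comm, h, mul_zero]

/-! ## Ideals of true grade one and two -/

/-- An ideal with zero annihilator. -/
def Ideal.IsFaithful {R : Type*} [CommRing R] (I : Ideal R) : Prop :=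
  ∀ x : R, (∀ b ∈ I, b * x = 0) → x = 0

/-- A faithful ideal such that every family proportional to its elements is a multiple of them. -/
def Ideal.IsGradeTwo {R : Type*} [CommRing R] (I : Ideal R) : Prop :=
  I.IsFaithful ∧ ∀ y : R → R, (∀ a ∈ I, ∀ b ∈ I, a * y b = b * y a) → ∃ c, ∀ b ∈ I, y b = c * b

section Grade

variable {R : Type*} [CommRing R] {I J : Ideal R}

theorem Ideal.IsFaithful.mono (hI : I.IsFaithful) (h : I ≤ J) : J.IsFaithful :=
  fun x hx => hI x fun b hb => hx b (h hb)

theorem Ideal.isFaithful_span_range {ι : Type*} {a : ι → R} :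
    (Ideal.span (Set.range a)).IsFaithful ↔ ∀ x, (∀ i, a i * x = 0) → x = 0 := by
  refine ⟨fun h x hx => h x fun b hb => ?_, fun h x hx => h x fun i =>
    hx _ (Ideal.subset_span ⟨i, rfl⟩)⟩
  induction hb using Submodule.span_induction with
  | mem b hb => obtain ⟨i, rfl⟩ := hb; exact hx i
  | zero => rw [zero_mul]
  | add b c _ _ h1 h2 => rw [add_mul, h1, h2, add_zero]
  | smul r b _ h1 => rw [smul_eq_mul, mul_assoc, h1, mul_zero]

/-- The multiplier `c` found on `I` still works on `J`: for `a ∈ I` and `z ∈ J`, `a * y z = z * y a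
= a * (c * z)`, and `I` is faithful. -/
theorem Ideal.IsGradeTwo.mono (hI : I.IsGradeTwo) (h : I ≤ J) : J.IsGradeTwo := by
  refine ⟨hI.1.mono h, fun y hy => ?_⟩
  obtain ⟨c, hc⟩ := hI.2 y fun a ha b hb => hy a (h ha) b (h hb)
  refine ⟨c, fun z hz => sub_eq_zero.mp (hI.1 _ fun a ha => ?_)⟩
  rw [mul_sub, hy a (h ha) z hz, hc a ha]
  ring

/-- It is enough to test generators: a proportional family on them extends to the whole ideal
through chosen linear expressions, since proportionality is bilinear. -/
theorem Ideal.IsGradeTwo.exists_eq_mul {ι : Type*} {a : ι → R}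
    (hI : (Ideal.span (Set.range a)).IsGradeTwo) (y : ι → R)
    (hy : ∀ i j, a i * y j = a j * y i) : ∃ c, ∀ i, y i = c * a i := by
  classical
  have hrep : ∀ b : R, ∃ l : ι →₀ R, b ∈ Ideal.span (Set.range a) →
      Finsupp.linearCombination R a l = b := fun b => by
    by_cases hb : b ∈ Ideal.span (Set.range a)
    · obtain ⟨l, hl⟩ := (Finsupp.mem_span_range_iff_exists_finsupp).mp hb
      exact ⟨l, fun _ => by rw [Finsupp.linearCombination_apply, hl]⟩
    · exact ⟨0, fun h => absurd h hb⟩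
  choose l hl using hrep
  have key : ∀ l l' : ι →₀ R, Finsupp.linearCombination R a l * Finsupp.linearCombination R y l' =
      Finsupp.linearCombination R a l' * Finsupp.linearCombination R y l := fun l l' => by
    simp only [Finsupp.linearCombination_apply, Finsupp.sum, Finset.sum_mul_sum, smul_eq_mul]
    rw [Finset.sum_comm]
    refine Finset.sum_congr rfl fun i _ => Finset.sum_congr rfl fun j _ => ?_
    linear_combination (l j * l' i) * hy j i
  obtain ⟨c, hc⟩ := hI.2 (fun b => Finsupp.linearCombination R y (l b)) fun b hb b' hb' => by
    have := key (l b) (l b')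
    rwa [hl b hb, hl b' hb'] at this
  refine ⟨c, fun i => ?_⟩
  have hai : a i ∈ Ideal.span (Set.range a) := Ideal.subset_span ⟨i, rfl⟩
  rw [← hc _ hai]
  -- The expression chosen for `a i` need not be the trivial one; faithfulness shows that it still
  -- yields `y i`.
  refine sub_eq_zero.mp (Ideal.isFaithful_span_range.mp hI.1 _ fun j => ?_)
  have h1 := key (l (a i)) (Finsupp.single j 1)
  rw [hl _ hai] at h1
  simp only [Finsupp.linearCombination_single, one_smul] at h1
  rw [mul_sub, ← h1, hy j i]
  ring

/-- The quotients of the `z * b` by `y` are proportional to the `b`, because `y` can be cancelled;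
their common multiplier is the quotient of `z` by `y`. -/
theorem Ideal.IsGradeTwo.dvd_of_forall_dvd_mul (hI : I.IsGradeTwo) {y z : R}
    (hy : y ∈ nonZeroDivisors R) (h : ∀ b ∈ I, y ∣ z * b) : y ∣ z := by
  classical
  choose! q hq using h
  obtain ⟨c, hc⟩ := hI.2 q fun a ha b hb => by
    refine sub_eq_zero.mp ((mem_nonZeroDivisors_iff.mp hy).1 _ ?_)
    linear_combination b * hq a ha - a * hq b hb
  refine ⟨c, sub_eq_zero.mp (hI.1 _ fun b hb => ?_)⟩
  have := hq b hb
  rw [hc b hb] at this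
  linear_combination this

open MvPolynomial in
theorem Ideal.IsGradeTwo.exists_eq_mul_C {ι : Type*} [Finite ι] {σ : Type*} {a : ι → R}
    (hI : (Ideal.span (Set.range a)).IsGradeTwo) (y : ι → MvPolynomial σ R)
    (hy : ∀ i j, C (a i) * y j = C (a j) * y i) : ∃ c, ∀ i, y i = c * C (a i) := by
  classical
  cases nonempty_fintype ι
  choose c hc using fun m : σ →₀ ℕ => hI.exists_eq_mul (fun i => coeff m (y i)) fun i j => by
    have := congrArg (coeff m) (hy i j)
    simpa only [coeff_C_mul] using this
  refine ⟨∑ m ∈ Finset.univ.biUnion fun i => (y i).support, monomial m (c m), fun i => ?_⟩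
  ext m
  rw [mul_comm, coeff_C_mul, coeff_sum]
  simp only [coeff_monomial, Finset.sum_ite_eq']
  split_ifs with hm
  · rw [hc m i, mul_comm]
  · rw [mul_zero]
    by_contra hne
    exact hm (Finset.mem_biUnion.mpr ⟨i, Finset.mem_univ _, mem_support_iff.mpr hne⟩)

end Grade

/-! ## Comparison with Kronecker sequences -/

section Kronecker

open MvPolynomial RingTheory.Sequence

variable {R : Type*} [CommRing R] {I J : Ideal R}

theorem isWeaklyRegular_pair_iff {S : Type*} [CommRing S] (f g : S) :
    IsWeaklyRegular S [f, g] ↔ (∀ x, f * x = 0 → x = 0) ∧ ∀ x, f ∣ g * x → f ∣ x := by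
  rw [isWeaklyRegular_cons_iff, isWeaklyRegular_singleton_iff,
    isSMulRegular_iff_right_eq_zero_of_smul]
  refine and_congr_right' ((isSMulRegular_quotient_iff_mem_of_smul_mem _ _).trans ?_)
  simp only [Submodule.mem_smul_pointwise_iff_exists, Submodule.mem_top, true_and, smul_eq_mul,
    dvd_iff_exists_eq_mul_right, eq_comm]

theorem span_range_eq_of_fg (hI : I.FG) : ∃ (n : ℕ) (a : Fin n → R), Ideal.span (Set.range a) = I :=
  Submodule.fg_iff_exists_fin_generating_family.mp hI

theorem depthGE_one_iff : DepthGE 1 I ↔ I.FG ∧ I.IsFaithful := by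
  constructor
  · classical
    rintro ⟨n, a, rfl, h⟩
    refine ⟨⟨Finset.univ.image a, by simp⟩, Ideal.isFaithful_span_range.mpr fun x hx => ?_⟩
    simp only [kroneckerSeq, List.ofFn_succ, List.ofFn_zero, isWeaklyRegular_singleton_iff,
      isSMulRegular_iff_right_eq_zero_of_smul, smul_eq_mul] at h
    refine C_eq_zero.mp (h (C x) ?_)
    rw [Finset.sum_mul]
    refine Finset.sum_eq_zero fun i _ => ?_
    rw [mul_right_comm, ← C_mul, hx, C_0, zero_mul]
  · rintro ⟨hfg, hI⟩
    obtain ⟨n, a, rfl⟩ := span_range_eq_of_fg hfg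
    refine ⟨n, a, rfl, ?_⟩
    simp only [kroneckerSeq, List.ofFn_succ, List.ofFn_zero, isWeaklyRegular_singleton_iff,
      isSMulRegular_iff_right_eq_zero_of_smul, smul_eq_mul]
    intro g hg
    let e := renameEquiv R (Equiv.uniqueProd (Fin n) (Fin 1))
    refine e.injective ?_
    rw [map_zero]
    refine eq_zero_of_linearForm_mul_eq_zero (Ideal.isFaithful_span_range.mp hI) _ ?_
    have := congrArg e hg
    rw [map_mul, map_zero] at this
    rw [← this]
    congr 1
    simp [e, map_sum]

/-- The variables of two disjoint blocks, the second block first. -/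
noncomputable def twoBlocksEquiv (R : Type*) [CommRing R] (n : ℕ) :
    MvPolynomial (Fin 2 × Fin n) R ≃ₐ[R] MvPolynomial (Fin n) (MvPolynomial (Fin n) R) :=
  (renameEquiv R (((finTwoEquiv.prodCongr (Equiv.refl (Fin n))).trans
    (Equiv.boolProdEquivSum (Fin n))).trans (Equiv.sumComm _ _))).trans
    (sumAlgEquiv R (Fin n) (Fin n))

theorem twoBlocksEquiv_X_zero (n : ℕ) (i : Fin n) :
    twoBlocksEquiv R n (X (0, i)) = C (X i) := by
  simp [twoBlocksEquiv, finTwoEquiv, sumAlgEquiv_X_inr]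

theorem twoBlocksEquiv_X_one (n : ℕ) (i : Fin n) :
    twoBlocksEquiv R n (X (1, i)) = X i := by
  simp [twoBlocksEquiv, finTwoEquiv, sumAlgEquiv_X_inl]

theorem twoBlocksEquiv_C (n : ℕ) (r : R) :
    twoBlocksEquiv R n (C r) = C (C r) := by
  simp [twoBlocksEquiv, sumAlgEquiv_C_inl]

/-- This is McCoy's theorem over the quotient by the first linear form `f`. The `a i` are faithful
there: if `a i * x = f * y i`, cancelling `f` makes the `y i` proportional to the `a i`, hence `y i
= c * a i` and `x = f * c`. -/
theorem Ideal.IsGradeTwo.dvd_of_dvd_linearForm_mul {n : ℕ} {a : Fin n → R}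
    (hI : (Ideal.span (Set.range a)).IsGradeTwo)
    (g : MvPolynomial (Fin n) (MvPolynomial (Fin n) R))
    (hg : C (∑ i, C (a i) * X i) ∣ (∑ i, C (C (a i)) * X i) * g) :
    C (∑ i, C (a i) * X i) ∣ g := by
  set f : MvPolynomial (Fin n) R := ∑ i, C (a i) * X i with hf
  have hreg : ∀ x, f * x = 0 → x = 0 := fun x hx =>
    eq_zero_of_linearForm_mul_eq_zero (Ideal.isFaithful_span_range.mp hI.1) x hx
  have hq : ∀ x, Ideal.Quotient.mk (Ideal.span {f}) x = 0 ↔ f ∣ x := fun x => by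
    rw [Ideal.Quotient.eq_zero_iff_mem, Ideal.mem_span_singleton]
  rw [C_dvd_iff_map_hom_eq_zero _ _ hq] at hg ⊢
  rw [map_mul, map_sum] at hg
  simp only [map_mul, map_C, map_X] at hg
  refine eq_zero_of_linearForm_mul_eq_zero (fun x hx => ?_) _ hg
  obtain ⟨x, rfl⟩ := Ideal.Quotient.mk_surjective x
  simp only [← map_mul, hq] at hx ⊢
  choose y hy using hx
  obtain ⟨c, hc⟩ := hI.exists_eq_mul_C y fun i j => by
    refine sub_eq_zero.mp (hreg _ ?_)
    linear_combination C (a j) * hy i - C (a i) * hy j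
  refine ⟨c, sub_eq_zero.mp ?_⟩
  refine MvPolynomial.ext _ _ fun m => Ideal.isFaithful_span_range.mp hI.1 _ fun i => ?_
  rw [← coeff_C_mul]
  have := hy i
  rw [hc i] at this
  rw [show C (a i) * (x - f * c) = 0 by linear_combination this, coeff_zero]

theorem kroneckerSeq_two {n : ℕ} (a : Fin n → R) :
    kroneckerSeq 2 a = [∑ i, C (a i) * X (0, i), ∑ i, C (a i) * X (1, i)] := by
  simp [kroneckerSeq, List.ofFn_succ]

theorem depthGE_two_iff : DepthGE 2 I ↔ I.FG ∧ I.IsGradeTwo := by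
  classical
  constructor
  · rintro ⟨n, a, rfl, h⟩
    rw [kroneckerSeq_two, isWeaklyRegular_pair_iff] at h
    have hf : (Ideal.span (Set.range a)).IsFaithful :=
      Ideal.isFaithful_span_range.mpr fun x hx => by
        refine C_eq_zero.mp (h.1 (C x) ?_)
        rw [Finset.sum_mul]
        refine Finset.sum_eq_zero fun i _ => ?_
        rw [mul_right_comm, ← C_mul, hx, C_0, zero_mul]
    refine ⟨⟨Finset.univ.image a, by simp⟩, hf, fun y hy => ?_⟩
    have ha : ∀ i, a i ∈ Ideal.span (Set.range a) := fun i => Ideal.subset_span ⟨i, rfl⟩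
    -- The form with coefficients `y (a i)` in the first variables, times the second Kronecker form,
    -- equals the first Kronecker form times the same form in the second variables. Regularity makes
    -- it a multiple `q` of the first Kronecker form, and the degree-one coefficients give the
    -- multiplier `coeff 0 q`.
    obtain ⟨q, hq⟩ := h.2 (∑ i, C (y (a i)) * X (0, i))
      ⟨∑ i, C (y (a i)) * X (1, i), by
        rw [Finset.sum_mul_sum, Finset.sum_mul_sum, Finset.sum_comm]
        refine Finset.sum_congr rfl fun i _ => Finset.sum_congr rfl fun j _ => ?_
        have := congrArg (C (σ := Fin 2 × Fin n)) (hy _ (ha i) _ (ha j))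
        rw [C_mul, C_mul] at this
        linear_combination (-X (0, i) * X (1, j)) * this⟩
    have hc : ∀ i, y (a i) = coeff 0 q * a i := fun i => by
      have := congrArg (coeff (Finsupp.single ((0 : Fin 2), i) 1)) hq
      rw [coeff_sum, Finset.sum_mul, coeff_sum] at this
      simp only [coeff_C_mul, mul_assoc, coeff_X_mul', coeff_X, Finsupp.single_left_inj one_ne_zero,
        Prod.mk.injEq, true_and, Finsupp.support_single _ (one_ne_zero (α := ℕ)),
        Finset.mem_singleton] at this
      rw [Finset.sum_eq_single i (by simp +contextual) (by simp),
        Finset.sum_eq_single i (by simp +contextual) (by simp)] at this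
      simpa [mul_comm] using this
    refine ⟨coeff 0 q, fun b hb => sub_eq_zero.mp
      (Ideal.isFaithful_span_range.mp hf _ fun i => ?_)⟩
    rw [mul_sub, hy _ (ha i) b hb, hc i]
    ring
  · rintro ⟨hfg, hI⟩
    obtain ⟨n, a, rfl⟩ := span_range_eq_of_fg hfg
    refine ⟨n, a, rfl, ?_⟩
    let e := twoBlocksEquiv R n
    have e0 : e (∑ i, C (a i) * X (0, i)) = C (∑ i, C (a i) * X i) := by
      simp only [e, map_sum, map_mul, twoBlocksEquiv_X_zero, twoBlocksEquiv_C]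
    have e1 : e (∑ i, C (a i) * X (1, i)) = ∑ i, C (C (a i)) * X i := by
      simp only [e, map_sum, map_mul, twoBlocksEquiv_X_one, twoBlocksEquiv_C]
    rw [kroneckerSeq_two, isWeaklyRegular_pair_iff]
    refine ⟨fun x hx => e.injective ?_, fun x hx => ?_⟩
    · have := congrArg e hx
      rw [map_mul, e0, map_zero] at this
      -- The first form is a constant for the outer variables, so McCoy's theorem applies to each
      -- outer coefficient separately.
      refine MvPolynomial.ext _ _ fun m => ?_
      refine (eq_zero_of_linearForm_mul_eq_zero
        (Ideal.isFaithful_span_range.mp hI.1) _ ?_).trans (by simp)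
      rw [← coeff_C_mul, this, coeff_zero]
    · rw [← map_dvd_iff e, e0]
      rw [← map_dvd_iff e, map_mul, e0, e1] at hx
      exact hI.dvd_of_dvd_linearForm_mul _ hx

theorem DepthGE.mono_two (h : DepthGE 2 I) (hJ : J.FG) (hIJ : I ≤ J) : DepthGE 2 J :=
  depthGE_two_iff.mpr ⟨hJ, (depthGE_two_iff.mp h).2.mono hIJ⟩

theorem DepthGE.mono_one (h : DepthGE 1 I) (hJ : J.FG) (hIJ : I ≤ J) : DepthGE 1 J :=
  depthGE_one_iff.mpr ⟨hJ, (depthGE_one_iff.mp h).2.mono hIJ⟩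

end Kronecker

/-! ## The top exterior power and the pairing of complementary degrees -/

section Exterior

variable {R : Type*} [CommRing R]

theorem exteriorPower.induction_on {M : Type*} [AddCommGroup M] [Module R M] {n : ℕ}
    {P : ⋀[R]^n M → Prop} (x : ⋀[R]^n M) (ι : ∀ v, P (exteriorPower.ιMulti R n v))
    (zero : P 0) (add : ∀ x y, P x → P y → P (x + y)) (smul : ∀ (r : R) x, P x → P (r • x)) :
    P x := by
  have hx : x ∈ Submodule.span R (Set.range (exteriorPower.ιMulti R n (M := M))) := by
    rw [exteriorPower.ιMulti_span]; trivial
  induction hx using Submodule.span_induction with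
  | mem y hy => obtain ⟨v, rfl⟩ := hy; exact ι v
  | zero => exact zero
  | add y z _ _ hy hz => exact add y z hy hz
  | smul r y _ hy => exact smul r y hy

/-- The increasing enumeration of a subset of `Fin n`. -/
noncomputable abbrev subsetEnum {n p : ℕ} (I : Set.powersetCard (Fin n) p) : Fin p ↪o Fin n :=
  Set.powersetCard.ofFinEmbEquiv.symm I

theorem coords_ιMulti {n p : ℕ} (v : Fin p → Fin n → R) (I : Set.powersetCard (Fin n) p) :
    coords (exteriorPower.ιMulti R p v) I = (Matrix.of fun i j => v i (subsetEnum I j)).det := by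
  rw [coords, natBasis, exteriorPower.basis_repr_apply, exteriorPower.ιMultiDual_apply_ιMulti]
  simp

theorem natBasis_apply {n p : ℕ} (I : Set.powersetCard (Fin n) p) :
    natBasis R n p I = exteriorPower.ιMulti R p fun i => Pi.single (subsetEnum I i) 1 := by
  rw [natBasis, exteriorPower.basis_apply, exteriorPower.ιMulti_family]
  congr 1
  ext i
  simp

theorem subsetEnum_univ {n : ℕ} (I : Set.powersetCard (Fin n) n) (j : Fin n) :
    subsetEnum I j = j := by
  have hs := Finite.surjective_of_injective (subsetEnum I).injective
  exact congrFun (((subsetEnum I).strictMono.range_inj strictMono_id).mp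
    (by rw [hs.range_eq, Set.range_id])) j

/-- `x ↦ [x]` as a linear form. -/
noncomputable def topForm (R : Type*) [CommRing R] (n : ℕ) : ⋀[R]^n (Fin n → R) →ₗ[R] R :=
  (natBasis R n n).coord ⟨Finset.univ, by simp⟩

theorem topForm_eq_topCoeff {n : ℕ} (x : ⋀[R]^n (Fin n → R)) : topForm R n x = topCoeff x := rfl

theorem topForm_ιMulti {n : ℕ} (v : Fin n → Fin n → R) :
    topForm R n (exteriorPower.ιMulti R n v) = (Matrix.of v).det := by
  rw [topForm_eq_topCoeff, topCoeff, coords_ιMulti]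
  simp only [subsetEnum_univ]

theorem wedge_ιMulti {M : Type*} [AddCommGroup M] [Module R M] {p q : ℕ}
    (a : Fin p → M) (b : Fin q → M) :
    wedge (exteriorPower.ιMulti R p a) (exteriorPower.ιMulti R q b) =
      exteriorPower.ιMulti R (p + q) (Fin.append a b) :=
  Subtype.ext (ExteriorAlgebra.ιMulti_mul_ιMulti a b)

/-- The exterior product as a bilinear map. -/
noncomputable def wedgeHom (R : Type*) [CommRing R] (M : Type*) [AddCommGroup M] [Module R M]
    (p q : ℕ) : ⋀[R]^p M →ₗ[R] ⋀[R]^q M →ₗ[R] ⋀[R]^(p + q) M :=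
  LinearMap.mk₂ R wedge
    (fun _ _ _ => Subtype.ext (add_mul _ _ _)) (fun _ _ _ => Subtype.ext (smul_mul_assoc _ _ _))
    (fun _ _ _ => Subtype.ext (mul_add _ _ _)) (fun _ _ _ => Subtype.ext (mul_smul_comm _ _ _))

/-- The pairing `(x, y) ↦ [x ∧ y]`. -/
noncomputable def topPairing (R : Type*) [CommRing R] (p q : ℕ) :
    ⋀[R]^p (Fin (p + q) → R) →ₗ[R] ⋀[R]^q (Fin (p + q) → R) →ₗ[R] R :=
  (wedgeHom R (Fin (p + q) → R) p q).compr₂ (topForm R (p + q))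

theorem topPairing_apply {p q : ℕ} (x : ⋀[R]^p (Fin (p + q) → R))
    (y : ⋀[R]^q (Fin (p + q) → R)) : topPairing R p q x y = topCoeff (wedge x y) := rfl

theorem topPairing_ιMulti {p q : ℕ} (a : Fin p → Fin (p + q) → R) (b : Fin q → Fin (p + q) → R) :
    topPairing R p q (exteriorPower.ιMulti R p a) (exteriorPower.ιMulti R q b) =
      (Matrix.of (Fin.append a b)).det := by
  rw [topPairing_apply, wedge_ιMulti, ← topForm_eq_topCoeff, topForm_ιMulti]

theorem det_of_comp {n : ℕ} (f : (Fin n → R) →ₗ[R] (Fin n → R)) (v : Fin n → Fin n → R) :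
    (Matrix.of (f ∘ v)).det = LinearMap.det f * (Matrix.of v).det := by
  have h := (Pi.basisFun R (Fin n)).det_comp f v
  rwa [Pi.basisFun_det] at h

theorem topForm_map {n : ℕ} (f : (Fin n → R) →ₗ[R] (Fin n → R)) (x : ⋀[R]^n (Fin n → R)) :
    topForm R n (exteriorPower.map n f x) = LinearMap.det f * topForm R n x := by
  induction x using exteriorPower.induction_on with
  | ι v => rw [exteriorPower.map_apply_ιMulti, topForm_ιMulti, topForm_ιMulti, det_of_comp]
  | zero => simp
  | add y z hy hz => simp only [map_add, mul_add, hy, hz]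
  | smul r y hy => simp only [map_smul, smul_eq_mul, hy]; ring

theorem topPairing_map {p q : ℕ} (f : (Fin (p + q) → R) →ₗ[R] (Fin (p + q) → R))
    (x : ⋀[R]^p (Fin (p + q) → R)) (y : ⋀[R]^q (Fin (p + q) → R)) :
    topPairing R p q (exteriorPower.map p f x) (exteriorPower.map q f y) =
      LinearMap.det f * topPairing R p q x y := by
  induction x using exteriorPower.induction_on with
  | ι a =>
    induction y using exteriorPower.induction_on with
    | ι b =>
      have h : Fin.append (f ∘ a) (f ∘ b) = f ∘ Fin.append a b := by
        ext i : 1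
        induction i using Fin.addCases <;> simp
      rw [exteriorPower.map_apply_ιMulti, exteriorPower.map_apply_ιMulti, topPairing_ιMulti,
        topPairing_ιMulti, h, det_of_comp]
    | zero => simp
    | add y z hy hz => simp only [map_add, mul_add, hy, hz]
    | smul r y hy => simp only [map_smul, smul_eq_mul, hy]; ring
  | zero => simp
  | add y z hy hz => simp only [map_add, LinearMap.add_apply, mul_add, hy, hz]
  | smul r y hy => simp only [map_smul, LinearMap.smul_apply, smul_eq_mul, hy]; ring

/-- Projecting to the positions in `I` turns one coordinate into a top coefficient, so that
statements about coordinates reduce to square determinants. -/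
theorem topForm_map_funLeft {n p : ℕ} (I : Set.powersetCard (Fin n) p)
    (x : ⋀[R]^p (Fin n → R)) :
    topForm R p (exteriorPower.map p (LinearMap.funLeft R R (subsetEnum I)) x) = coords x I := by
  have : topForm R p ∘ₗ exteriorPower.map p (LinearMap.funLeft R R (subsetEnum I)) =
      (natBasis R n p).coord I := by
    refine exteriorPower.linearMap_ext (AlternatingMap.ext fun v => ?_)
    simp only [LinearMap.compAlternatingMap_apply, LinearMap.comp_apply,
      exteriorPower.map_apply_ιMulti, topForm_ιMulti]
    exact (coords_ιMulti v I).symm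
  exact LinearMap.congr_fun this x

theorem topPairing_natBasis_of_ne {p q : ℕ} (I : Set.powersetCard (Fin (p + q)) p)
    (J : Set.powersetCard (Fin (p + q)) q) (h : ¬ Disjoint I.val J.val) :
    topPairing R p q (natBasis R (p + q) p I) (natBasis R (p + q) q J) = 0 := by
  rw [topPairing_apply]
  have : wedge (natBasis R (p + q) p I) (natBasis R (p + q) q J) = 0 := by
    refine Subtype.ext ?_
    simp only [wedge, natBasis, exteriorPower.basis_apply]
    exact ExteriorAlgebra.ιMulti_family_mul_of_not_disjoint R _ I J h
  rw [this]
  exact map_zero (topForm R (p + q))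

theorem isUnit_topPairing_natBasis {p q : ℕ} (I : Set.powersetCard (Fin (p + q)) p)
    (J : Set.powersetCard (Fin (p + q)) q) (h : Disjoint I.val J.val) :
    IsUnit (topPairing R p q (natBasis R (p + q) p I) (natBasis R (p + q) q J)) := by
  rw [topPairing_apply]
  have : wedge (natBasis R (p + q) p I) (natBasis R (p + q) q J) =
      Equiv.Perm.sign (Set.powersetCard.permOfDisjoint h) •
        natBasis R (p + q) (p + q) (Set.powersetCard.disjUnion h) := by
    refine Subtype.ext ?_
    simp only [wedge, natBasis, exteriorPower.basis_apply]
    exact ExteriorAlgebra.ιMulti_family_mul_of_disjoint R _ I J h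
  rw [this, ← topForm_eq_topCoeff, Units.smul_def, map_zsmul, topForm]
  have hu : Set.powersetCard.disjUnion h = ⟨Finset.univ, by simp⟩ := by
    refine Subtype.ext (Finset.eq_univ_of_card _ ?_)
    rw [Set.powersetCard.card_eq, Fintype.card_fin]
  rw [hu, Module.Basis.coord_apply, Module.Basis.repr_self, Finsupp.single_eq_same, zsmul_one]
  exact (Equiv.Perm.sign (Set.powersetCard.permOfDisjoint h)).isUnit.map (Int.castRingHom R)

theorem sum_coords_smul {n p : ℕ} (x : ⋀[R]^p (Fin n → R)) :
    ∑ I, coords x I • natBasis R n p I = x :=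
  (natBasis R n p).sum_repr x

theorem coords_hodge {p q : ℕ} (x : ⋀[R]^p (Fin (p + q) → R))
    (J : Set.powersetCard (Fin (p + q)) q) :
    coords (hodge x) J = topPairing R p q x (natBasis R (p + q) q J) := by
  classical
  have := (natBasis R (p + q) q).repr_sum_self fun J =>
    topCoeff (wedge x (natBasis R (p + q) q J))
  exact congrFun this J

theorem mem_coordIdeal {n p : ℕ} (x : ⋀[R]^p (Fin n → R)) (I) : coords x I ∈ coordIdeal x :=
  Ideal.subset_span ⟨I, rfl⟩

theorem linearForm_mem_coordIdeal {n p : ℕ} (l : ⋀[R]^p (Fin n → R) →ₗ[R] R)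
    (x : ⋀[R]^p (Fin n → R)) : l x ∈ coordIdeal x := by
  rw [← sum_coords_smul x, map_sum, sum_coords_smul x]
  refine Ideal.sum_mem _ fun I _ => ?_
  rw [map_smul, smul_eq_mul]
  exact Ideal.mul_mem_right _ _ (mem_coordIdeal x I)

theorem coordIdeal_map_le {n p n' p' : ℕ}
    (l : ⋀[R]^p (Fin n → R) →ₗ[R] ⋀[R]^p' (Fin n' → R)) (x : ⋀[R]^p (Fin n → R)) :
    coordIdeal (l x) ≤ coordIdeal x := by
  rw [coordIdeal, Ideal.span_le]
  rintro _ ⟨I, rfl⟩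
  exact linearForm_mem_coordIdeal ((natBasis R n' p').coord I ∘ₗ l) x

/-- Pairing `x` with the basis vector of the complement of `I` isolates `± x_I`. This gives the
content ideal without coordinates, and shows that `x` and its Hodge dual have the same content. -/
theorem coordIdeal_eq_range {p q : ℕ} (x : ⋀[R]^p (Fin (p + q) → R)) :
    coordIdeal x = LinearMap.range (topPairing R p q x) := by
  refine le_antisymm ?_ ?_
  · rw [coordIdeal, Ideal.span_le]
    rintro _ ⟨I, rfl⟩
    let J : Set.powersetCard (Fin (p + q)) q :=
      Set.powersetCard.compl (by simp [add_comm]) I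
    have hIJ : Disjoint I.val J.val := by
      rw [Set.powersetCard.coe_compl]
      exact disjoint_compl_right
    obtain ⟨c, hc⟩ := (isUnit_topPairing_natBasis (R := R) I J hIJ).exists_right_inv
    refine ⟨c • natBasis R (p + q) q J, ?_⟩
    rw [map_smul]
    conv_lhs => rw [← sum_coords_smul x]
    rw [map_sum, LinearMap.sum_apply, Finset.sum_eq_single I]
    · rw [map_smul, LinearMap.smul_apply, smul_eq_mul, smul_eq_mul]
      linear_combination coords x I * hc
    · intro I' _ hne
      rw [map_smul, LinearMap.smul_apply, topPairing_natBasis_of_ne, smul_zero]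
      rw [Set.powersetCard.coe_compl]
      intro hdis
      have hsub := disjoint_compl_right_iff.mp hdis
      exact hne (Set.powersetCard.eq_iff_subset.mpr hsub)
    · simp
  · rintro _ ⟨y, rfl⟩
    exact linearForm_mem_coordIdeal ((topPairing R p q).flip y) x

theorem span_coords_hodge {p q : ℕ} (x : ⋀[R]^p (Fin (p + q) → R)) :
    Ideal.span (Set.range (coords (hodge x))) = coordIdeal x := by
  rw [coordIdeal_eq_range, LinearMap.range_eq_map, ← (natBasis R (p + q) q).span_eq,
    Submodule.map_span, ← Set.range_comp]
  congr 2
  ext J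
  exact coords_hodge x J

theorem coordIdeal_fg {n p : ℕ} (x : ⋀[R]^p (Fin n → R)) : (coordIdeal x).FG :=
  Submodule.fg_span (Set.finite_range _)

/-! ## Minors and the factorization of exterior powers of matrices -/

theorem extMatrix_apply {a b p : ℕ} (A : Matrix (Fin a) (Fin b) R)
    (I : Set.powersetCard (Fin a) p) (J : Set.powersetCard (Fin b) p) :
    extMatrix p A I J = coords (exteriorPower.map p (Matrix.toLin' A) (natBasis R b p J)) I := by
  classical
  rw [extMatrix, LinearMap.toMatrix_apply]
  rfl

theorem extMatrix_eq_det {a b p : ℕ} (A : Matrix (Fin a) (Fin b) R)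
    (I : Set.powersetCard (Fin a) p) (J : Set.powersetCard (Fin b) p) :
    extMatrix p A I J = (A.submatrix (subsetEnum I) (subsetEnum J)).det := by
  rw [extMatrix_apply, natBasis_apply, exteriorPower.map_apply_ιMulti, coords_ιMulti,
    ← Matrix.det_transpose]
  congr 1
  ext i j
  simp

theorem linearForm_map_mem_detIdeal {a b p : ℕ} (A : Matrix (Fin a) (Fin b) R)
    (l : ⋀[R]^p (Fin a → R) →ₗ[R] R) (x : ⋀[R]^p (Fin b → R)) :
    l (exteriorPower.map p (Matrix.toLin' A) x) ∈
      Ideal.span {d | ∃ I J, d = extMatrix p A I J} := by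
  rw [← sum_coords_smul x, map_sum, map_sum]
  refine Ideal.sum_mem _ fun J _ => ?_
  rw [map_smul, map_smul, smul_eq_mul]
  refine Ideal.mul_mem_left _ _ ?_
  rw [← sum_coords_smul (exteriorPower.map p (Matrix.toLin' A) _), map_sum]
  refine Ideal.sum_mem _ fun I _ => ?_
  rw [map_smul, smul_eq_mul, ← extMatrix_apply]
  exact Ideal.mul_mem_right _ _ (Ideal.subset_span ⟨I, J, rfl⟩)

/-- Minors with repeated or unordered rows and columns add nothing: each is a linear form evaluated
on the image of an exterior product under `⋀ᵖ A`. -/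
theorem detIdeal_eq_span_extMatrix {a b : ℕ} (p : ℕ) (A : Matrix (Fin a) (Fin b) R) :
    detIdeal p A = Ideal.span {d | ∃ I J, d = extMatrix p A I J} := by
  refine le_antisymm ?_ ?_
  · rw [detIdeal, Ideal.span_le]
    rintro _ ⟨f, g, rfl⟩
    have := linearForm_map_mem_detIdeal A (exteriorPower.pairingDual R (Fin a → R) p
      (exteriorPower.ιMulti R p fun i => LinearMap.proj (f i)))
      (exteriorPower.ιMulti R p fun i => Pi.single (g i) 1)
    rw [exteriorPower.map_apply_ιMulti, exteriorPower.pairingDual_ιMulti_ιMulti,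
      ← Matrix.det_transpose] at this
    have hdet : A.submatrix f g = (Matrix.of fun i j => LinearMap.proj (R := R) (f j)
        ((Matrix.toLin' A ∘ fun i => Pi.single (g i) 1) i)).transpose := by
      ext i j
      simp
    rw [SetLike.mem_coe, hdet]
    exact this
  · rw [Ideal.span_le]
    rintro _ ⟨I, J, rfl⟩
    rw [extMatrix_eq_det]
    exact Ideal.subset_span ⟨_, _, rfl⟩

/-- The basis-free form of the rank-one factorization, used in all later arguments in place of the
matrix identity. -/
theorem extMatrix_eq_vecMulVec_iff {a p q : ℕ} {A : Matrix (Fin a) (Fin (p + q)) R}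
    {u : ⋀[R]^q (Fin a → R)} {w : ⋀[R]^p (Fin (p + q) → R)} :
    extMatrix q A = Matrix.vecMulVec (coords u) (coords (hodge w)) ↔
      ∀ v, exteriorPower.map q (Matrix.toLin' A) v = topPairing R p q w v • u := by
  constructor
  · intro h v
    have : exteriorPower.map q (Matrix.toLin' A) = (topPairing R p q w).smulRight u := by
      refine (natBasis R (p + q) q).ext fun J => (natBasis R a q).ext_elem fun I => ?_
      have h1 := congrFun (congrFun h I) J
      rw [extMatrix_apply, Matrix.vecMulVec_apply, coords_hodge] at h1
      simp only [LinearMap.smulRight_apply, map_smul, Finsupp.smul_apply, smul_eq_mul]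
      rw [mul_comm]
      exact h1
    rw [this, LinearMap.smulRight_apply]
  · intro h
    ext I J
    rw [extMatrix_apply, h, Matrix.vecMulVec_apply, coords_hodge, mul_comm]
    simp [coords]

theorem detIdeal_eq_mul {a p q : ℕ} {A : Matrix (Fin a) (Fin (p + q)) R}
    {u : ⋀[R]^q (Fin a → R)} {w : ⋀[R]^p (Fin (p + q) → R)}
    (h : extMatrix q A = Matrix.vecMulVec (coords u) (coords (hodge w))) :
    detIdeal q A = coordIdeal w * coordIdeal u := by
  rw [mul_comm, ← span_coords_hodge w, coordIdeal, Ideal.span_mul_span', detIdeal_eq_span_extMatrix]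
  congr 1
  ext d
  rw [Set.mem_mul]
  constructor
  · rintro ⟨I, J, rfl⟩
    exact ⟨_, ⟨I, rfl⟩, _, ⟨J, rfl⟩, by rw [h, Matrix.vecMulVec_apply]⟩
  · rintro ⟨_, ⟨I, rfl⟩, _, ⟨J, rfl⟩, rfl⟩
    exact ⟨I, J, by rw [h, Matrix.vecMulVec_apply]⟩

/-- The values of the pairing with `w` fill the content ideal of `w`, so faithfulness allows them to
be cancelled. Uniqueness and all comparisons of factorization vectors rest on this. -/
theorem eq_of_forall_topPairing_smul_eq {p q n s : ℕ} {w : ⋀[R]^p (Fin (p + q) → R)}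
    (hw : (coordIdeal w).IsFaithful) {u u' : ⋀[R]^s (Fin n → R)}
    (h : ∀ v, topPairing R p q w v • u = topPairing R p q w v • u') : u = u' := by
  refine (natBasis R n s).ext_elem fun I => sub_eq_zero.mp (hw _ fun b hb => ?_)
  rw [coordIdeal_eq_range] at hb
  obtain ⟨v, rfl⟩ := hb
  have := congrArg (fun x => (natBasis R n s).repr x I) (h v)
  simp only [map_smul, Finsupp.smul_apply, smul_eq_mul] at this
  rw [mul_sub, this, sub_self]

end Exterior

/-! ## Existence of the factorization -/

section Existence

variable {R : Type*} [CommRing R]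

/-- Stack `N` on `f` to get an endomorphism `F` and take `d = det F`. Since `f ∘ g = 0`, `F` sends
vectors `g a` into the first `p` positions, and the determinant of `F` applied to `g a` and `b` is
block triangular. -/
theorem det_mul_topPairing_map {M : Type*} [AddCommGroup M] [Module R M] {p q : ℕ}
    (N : (Fin (p + q) → R) →ₗ[R] (Fin p → R)) (f : (Fin (p + q) → R) →ₗ[R] (Fin q → R))
    (g : M →ₗ[R] (Fin (p + q) → R)) (hfg : f ∘ₗ g = 0) :
    ∃ d : R, ∀ z v, d * topPairing R p q (exteriorPower.map p g z) v =
      topForm R p (exteriorPower.map p N (exteriorPower.map p g z)) *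
        topForm R q (exteriorPower.map q f v) := by
  let F : (Fin (p + q) → R) →ₗ[R] (Fin (p + q) → R) :=
    LinearMap.pi fun i => Fin.addCases (fun i => LinearMap.proj i ∘ₗ N)
      (fun i => LinearMap.proj i ∘ₗ f) i
  have hN : ∀ x i, F x (Fin.castAdd q i) = N x i := fun x i => by simp [F]
  have hf : ∀ x i, F x (Fin.natAdd p i) = f x i := fun x i => by simp [F]
  have hg : ∀ z i, f (g z) i = 0 := fun z i => congrFun (LinearMap.congr_fun hfg z) i
  refine ⟨LinearMap.det F, fun z v => ?_⟩
  rw [← topPairing_map]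
  induction z using exteriorPower.induction_on with
  | ι a =>
    induction v using exteriorPower.induction_on with
    | ι b =>
      simp only [exteriorPower.map_apply_ιMulti, topPairing_ιMulti, topForm_ιMulti]
      rw [← Matrix.det_submatrix_equiv_self finSumFinEquiv,
        ← Matrix.det_fromBlocks_zero₁₂ _ (Matrix.of fun i j => N (b i) j)]
      congr 1
      ext (i | i) (j | j) <;> simp [hN, hf, hg]
    | zero => simp
    | add y z hy hz => simp only [map_add, mul_add, hy, hz]
    | smul r y hy => simp only [map_smul, smul_eq_mul, hy]; ring
  | zero => simp
  | add y z hy hz => simp only [map_add, LinearMap.add_apply, add_mul, hy, hz]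
  | smul r y hy => simp only [map_smul, LinearMap.smul_apply, smul_eq_mul, hy]; ring

/-- If `f ∘ g = 0` and `⋀ᵖ g` has rank one, given by a vector `u` whose coordinates generate an
ideal of grade two, then `⋀^q f` has rank one and its rows are multiples of `u*`. -/
theorem exists_forall_map_eq_topPairing_smul {M : Type*} [AddCommGroup M] [Module R M]
    {p q a : ℕ} (f : (Fin (p + q) → R) →ₗ[R] (Fin a → R)) (g : M →ₗ[R] (Fin (p + q) → R))
    (hfg : f ∘ₗ g = 0) (u : ⋀[R]^p (Fin (p + q) → R)) (t : ⋀[R]^p M → R)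
    (ht : ∀ x : R, (∀ z, t z * x = 0) → x = 0)
    (hg : ∀ z, exteriorPower.map p g z = t z • u) (hu : (coordIdeal u).IsGradeTwo) :
    ∃ w : ⋀[R]^q (Fin a → R), ∀ v, exteriorPower.map q f v = topPairing R p q u v • w := by
  have hcross : ∀ I v w, topPairing R p q u v * coords (exteriorPower.map q f w) I =
      topPairing R p q u w * coords (exteriorPower.map q f v) I := by
    intro I v w
    -- `N` keeps the coordinates in `K` and `f` is cut down to the rows in `I`. Both sides then
    -- carry the factor `t z`, which is cancelled; the multiplier `d` does not depend on `v`.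
    have hd : ∀ K, ∃ d : R, ∀ v, d * topPairing R p q u v =
        coords u K * coords (exteriorPower.map q f v) I := fun K => by
      obtain ⟨d, hd⟩ := det_mul_topPairing_map (LinearMap.funLeft R R (subsetEnum K))
        (LinearMap.funLeft R R (subsetEnum I) ∘ₗ f) g
        (by rw [LinearMap.comp_assoc, hfg, LinearMap.comp_zero])
      refine ⟨d, fun v => sub_eq_zero.mp (ht _ fun z => ?_)⟩
      have := hd z v
      rw [hg, exteriorPower.map_comp, LinearMap.comp_apply, topForm_map_funLeft,
        topForm_map_funLeft, map_smul, LinearMap.smul_apply, smul_eq_mul] at this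
      have hc : coords (t z • u) K = t z * coords u K := by simp [coords]
      rw [hc] at this
      linear_combination this
    refine sub_eq_zero.mp (Ideal.isFaithful_span_range.mp hu.1 _ fun K => ?_)
    obtain ⟨d, hd⟩ := hd K
    linear_combination topPairing R p q u w * hd v - topPairing R p q u v * hd w
  have hspan := span_coords_hodge u
  rw [← hspan] at hu
  -- Row `I` of `⋀^q f` is proportional to the coordinates of `hodge u`, which generate an ideal of
  -- grade two; the multiplier `c I` is the coordinate of `w` at `I`.
  choose c hc using fun I => hu.exists_eq_mul
    (fun J => coords (exteriorPower.map q f (natBasis R (p + q) q J)) I) fun J J' => by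
      rw [coords_hodge, coords_hodge]
      exact hcross I _ _
  refine ⟨∑ I, c I • natBasis R a q I, fun v => ?_⟩
  have : exteriorPower.map q f =
      (topPairing R p q u).smulRight (∑ I, c I • natBasis R a q I) := by
    refine (natBasis R (p + q) q).ext fun J => (natBasis R a q).ext_elem fun I => ?_
    have h1 := hc I J
    rw [coords_hodge] at h1
    rw [LinearMap.smulRight_apply, map_smul, Finsupp.smul_apply,
      (natBasis R a q).repr_sum_self, smul_eq_mul, mul_comm]
    exact h1
  rw [this, LinearMap.smulRight_apply]

end Existence

/-! ### Uniqueness and existence of the factorization vectors of a Cayley complex -/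

namespace FreeComplex

variable {R : Type*} [CommRing R] {C : FreeComplex R} {u : C.VectorSystem}

theorem IsFactorization.map_eq (hu : C.IsFactorization u) (k : ℕ)
    (v : ⋀[R]^(C.r (k + 1)) (Fin (C.dim (k + 1)) → R)) :
    exteriorPower.map (C.r (k + 1)) (Matrix.toLin' (C.A k)) v =
      topPairing R (C.r (k + 2)) (C.r (k + 1)) (u (k + 1)) v • u k :=
  extMatrix_eq_vecMulVec_iff.mp (hu.2 k) v

theorem IsFactorization.charIdeal_eq (hu : C.IsFactorization u) (k : ℕ) :
    C.charIdeal k = C.factIdeal u (k + 1) * C.factIdeal u k :=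
  detIdeal_eq_mul (hu.2 k)

theorem factIdeal_fg (k : ℕ) : (C.factIdeal u k).FG := coordIdeal_fg _

theorem IsFactorization.depthGE_one (hC : C.IsCayley) (hu : C.IsFactorization u) :
    DepthGE 1 (C.factIdeal u 0) :=
  hC.1.mono_one (factIdeal_fg 0) ((hu.charIdeal_eq _).trans_le Ideal.mul_le_right)

theorem IsFactorization.depthGE_two (hC : C.IsCayley) (hu : C.IsFactorization u) {k : ℕ}
    (hk : 1 ≤ k) : DepthGE 2 (C.factIdeal u k) :=
  (hC.2 k hk).mono_two (factIdeal_fg k) ((hu.charIdeal_eq _).trans_le Ideal.mul_le_right)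

theorem IsFactorization.isFaithful_succ (hC : C.IsCayley) (hu : C.IsFactorization u) (k : ℕ) :
    (coordIdeal (u (k + 1))).IsFaithful :=
  (depthGE_two_iff.mp (hu.depthGE_two hC (Nat.succ_pos k))).2.1

/-- Descending induction along a complex: a property that holds in all large degrees and descends
by one degree holds in all degrees. -/
theorem descending_induction (C : FreeComplex R) {P : ℕ → Prop}
    (top : ∀ k, (∀ j, k < j → C.r j = 0) → P k) (step : ∀ k, P (k + 1) → P k) (k : ℕ) : P k := by
  obtain ⟨m, hm⟩ := C.bounded
  have h : ∀ d, P (k + m - d) := fun d => by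
    induction d with
    | zero => exact top _ fun j hj => hm j (by omega)
    | succ d ih =>
      by_cases hd : d < k + m
      · refine step _ ?_
        rwa [show k + m - (d + 1) + 1 = k + m - d by omega]
      · rwa [show k + m - (d + 1) = k + m - d by omega]
  simpa using h m

theorem IsFactorization.unique {u' : C.VectorSystem} (hC : C.IsCayley)
    (hu : C.IsFactorization u) (hu' : C.IsFactorization u') : u = u' := by
  funext k
  induction k using C.descending_induction with
  | top k hk => exact Subtype.ext ((hu.1 k hk).trans (hu'.1 k hk).symm)
  | step k ih =>
    refine eq_of_forall_topPairing_smul_eq (hu.isFaithful_succ hC k) fun v => ?_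
    rw [← hu.map_eq, hu'.map_eq, ih]

theorem map_eq_topPairing_smul_of_eq_one {a p q : ℕ} (hp : p = 0) (hq : q = 0)
    (f : (Fin (p + q) → R) →ₗ[R] (Fin a → R)) {u : ⋀[R]^q (Fin a → R)}
    {w : ⋀[R]^p (Fin (p + q) → R)} (hu : (u : ExteriorAlgebra R (Fin a → R)) = 1)
    (hw : (w : ExteriorAlgebra R (Fin (p + q) → R)) = 1) (v : ⋀[R]^q (Fin (p + q) → R)) :
    exteriorPower.map q f v = topPairing R p q w v • u := by
  subst hp hq
  obtain rfl : u = exteriorPower.ιMulti R 0 Fin.elim0 := Subtype.ext (by simp [hu])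
  obtain rfl : w = exteriorPower.ιMulti R 0 Fin.elim0 := Subtype.ext (by simp [hw])
  induction v using exteriorPower.induction_on with
  | ι v =>
    rw [topPairing_ιMulti, Matrix.det_isEmpty (n := Fin 0), one_smul, exteriorPower.map_apply_ιMulti]
    congr 1
    exact Subsingleton.elim _ _
  | zero => simp
  | add y z hy hz => simp only [map_add, add_smul, hy, hz]
  | smul r y hy => simp only [map_smul, smul_eq_mul, mul_smul, hy]

theorem exists_isFactorization (hC : C.IsCayley) : ∃ u : C.VectorSystem, C.IsFactorization u := by
  classical
  -- Minimality of `m` makes the normalization `u j = 1` concern exactly the degrees `j ≥ m`, so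
  -- that the vectors below `m` can be modified freely.
  obtain ⟨m, hm, hmin⟩ : ∃ m, (∀ j, m < j → C.r j = 0) ∧
      ∀ k, (∀ j, k < j → C.r j = 0) → m ≤ k :=
    ⟨Nat.find C.bounded, Nat.find_spec C.bounded, fun k hk => Nat.find_min' C.bounded hk⟩
  have hm' : ∀ {k}, m ≤ k → C.r (k + 1) = 0 := fun hk => hm _ (by omega)
  suffices h : ∀ k, ∃ u : C.VectorSystem,
      (∀ j, m ≤ j → (u j : ExteriorAlgebra R (Fin (C.dim j) → R)) = 1) ∧
      ∀ j, k ≤ j → extMatrix (C.r (j + 1)) (C.A j) =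
        Matrix.vecMulVec (coords (u j)) (coords (hodge (u (j + 1)))) by
    obtain ⟨u, h1, h2⟩ := h 0
    exact ⟨u, fun k hk => h1 k (hmin k hk), fun k => h2 k (Nat.zero_le k)⟩
  intro k
  induction k using C.descending_induction with
  | top k hk =>
    refine ⟨fun j => if h : m ≤ j then ⟨1, ?_⟩ else 0, fun j hj => ?_, fun j hj => ?_⟩
    · rw [hm' h]
      exact SetLike.GradedOne.one_mem
    · simp only [dif_pos hj]
    · have hmj := (hmin k hk).trans hj
      simp only [dif_pos hmj, dif_pos (Nat.le_succ_of_le hmj)]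
      exact extMatrix_eq_vecMulVec_iff.mpr (map_eq_topPairing_smul_of_eq_one
        (hm' (Nat.le_succ_of_le hmj)) (hm' hmj) _ rfl rfl)
  | step k ih =>
    obtain ⟨u, h1, h2⟩ := ih
    by_cases hk : m ≤ k
    · refine ⟨u, h1, fun j hj => ?_⟩
      rcases hj.eq_or_lt with rfl | hlt
      · exact extMatrix_eq_vecMulVec_iff.mpr (map_eq_topPairing_smul_of_eq_one
          (hm' (Nat.le_succ_of_le hk)) (hm' hk) _ (h1 _ hk) (h1 _ (Nat.le_succ_of_le hk)))
      · exact h2 j hlt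
    · have hfac := h2 (k + 1) le_rfl
      have hI : C.charIdeal (k + 1) = coordIdeal (u (k + 2)) * coordIdeal (u (k + 1)) :=
        detIdeal_eq_mul hfac
      have hG := (depthGE_two_iff.mp (hC.2 (k + 1) (Nat.succ_pos k))).2
      -- The inclusions of `𝔇_{k+2} = 𝔅_{k+2} 𝔅_{k+1}` in its two factors give both hypotheses:
      -- faithfulness of the values of `[u_{k+2} ∧ ·]` and grade two for `𝔅_{k+1}`.
      obtain ⟨w, hw⟩ := exists_forall_map_eq_topPairing_smul (Matrix.toLin' (C.A k))
        (Matrix.toLin' (C.A (k + 1))) (by rw [← Matrix.toLin'_mul, C.comp, map_zero])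
        (u (k + 1)) (topPairing R _ _ (u (k + 2)))
        (fun x hx => hG.1.mono (hI.trans_le Ideal.mul_le_left) x fun b hb => by
          rw [coordIdeal_eq_range] at hb
          obtain ⟨z, rfl⟩ := hb
          exact hx z)
        (extMatrix_eq_vecMulVec_iff.mp hfac) (hG.mono (hI.trans_le Ideal.mul_le_right))
      refine ⟨Function.update u k w, fun j hj => ?_, fun j hj => ?_⟩
      · rw [Function.update_of_ne (by omega)]
        exact h1 j hj
      · rw [Function.update_of_ne (by omega : j + 1 ≠ k)]
        rcases hj.eq_or_lt with rfl | hlt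
        · rw [Function.update_self]
          exact extMatrix_eq_vecMulVec_iff.mpr hw
        · rw [Function.update_of_ne hlt.ne']
          exact h2 j hlt

/-! ## Changes of bases -/

theorem toLin'_inv_comp {n : ℕ} (P : GL (Fin n) R) :
    Matrix.toLin' P.val ∘ₗ Matrix.toLin' (P⁻¹ : GL (Fin n) R).val = LinearMap.id := by
  rw [← Matrix.toLin'_mul, ← Units.val_mul, mul_inv_cancel, Units.val_one, Matrix.toLin'_one]

/-- The vectors of a change of bases. -/
theorem IsFactorization.changeBasis (hC : C.IsCayley)
    (hu : C.IsFactorization u) (P : ∀ k, GL (Fin (C.dim k)) R)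
    {u' : (C.changeBasis P).VectorSystem} (hu' : (C.changeBasis P).IsFactorization u') (k : ℕ) :
    ∃ c : Rˣ, u' k = c.val • exteriorPower.map (C.r (k + 1))
      (Matrix.toLin' ((P k)⁻¹ : GL (Fin (C.dim k)) R).val) (u k) := by
  induction k using C.descending_induction with
  | top k hk =>
    refine ⟨1, ?_⟩
    have h0 : ∀ {n : ℕ} (_ : n = 0) (f : (Fin (C.dim k) → R) →ₗ[R] (Fin (C.dim k) → R))
        (x y : ⋀[R]^n (Fin (C.dim k) → R)),
        (x : ExteriorAlgebra R (Fin (C.dim k) → R)) = 1 →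
        (y : ExteriorAlgebra R (Fin (C.dim k) → R)) = 1 → x = exteriorPower.map n f y := by
      intro n hn f x y hx hy
      subst hn
      obtain rfl : x = exteriorPower.ιMulti R 0 Fin.elim0 := Subtype.ext (by simp [hx])
      obtain rfl : y = exteriorPower.ιMulti R 0 Fin.elim0 := Subtype.ext (by simp [hy])
      rw [exteriorPower.map_apply_ιMulti]
      congr 1
      exact Subsingleton.elim _ _
    rw [Units.val_one, one_smul]
    exact h0 (hk _ (Nat.lt_succ_self k)) _ _ _ (hu'.1 k hk) (hu.1 k hk)
  | step k ih =>
    obtain ⟨c, hc⟩ := ih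
    obtain ⟨d, hd⟩ : ∃ d : Rˣ, d.val = LinearMap.det (Matrix.toLin' (P (k + 1)).val) :=
      ⟨Matrix.GeneralLinearGroup.det (P (k + 1)), by
        rw [LinearMap.det_toLin', Matrix.GeneralLinearGroup.val_det_apply]⟩
    -- The factorization of the new complex is tested on `⋀P⁻¹ v`. The determinant `d` comes from
    -- `[u ∧ v] = d [P⁻¹u ∧ P⁻¹v]`, and `c` is the unit from the degree above.
    refine ⟨c⁻¹ * d, eq_of_forall_topPairing_smul_eq (hu.isFaithful_succ hC k) fun v => ?_⟩
    have hinv : ∀ {p : ℕ} (x : ⋀[R]^p (Fin (C.dim (k + 1)) → R)),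
        exteriorPower.map p (Matrix.toLin' (P (k + 1)).val) (exteriorPower.map p
          (Matrix.toLin' ((P (k + 1))⁻¹ : GL (Fin (C.dim (k + 1))) R).val) x) = x := by
      intro p x
      rw [← LinearMap.comp_apply, ← exteriorPower.map_comp, toLin'_inv_comp,
        exteriorPower.map_id, LinearMap.id_apply]
    have h1 : exteriorPower.map (C.r (k + 1)) (Matrix.toLin'
          (((P k)⁻¹ : GL (Fin (C.dim k)) R).val * C.A k * (P (k + 1)).val))
        (exteriorPower.map _ (Matrix.toLin' ((P (k + 1))⁻¹ : GL (Fin (C.dim (k + 1))) R).val) v) =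
        topPairing R (C.r (k + 2)) (C.r (k + 1)) (u' (k + 1)) (exteriorPower.map _
          (Matrix.toLin' ((P (k + 1))⁻¹ : GL (Fin (C.dim (k + 1))) R).val) v) • u' k :=
      hu'.map_eq k _
    have h2 := topPairing_map (Matrix.toLin' (P (k + 1)).val)
      (exteriorPower.map _ (Matrix.toLin' ((P (k + 1))⁻¹ : GL (Fin (C.dim (k + 1))) R).val)
        (u (k + 1)))
      (exteriorPower.map _ (Matrix.toLin' ((P (k + 1))⁻¹ : GL (Fin (C.dim (k + 1))) R).val) v)
    rw [hinv, hinv, ← hd] at h2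
    rw [Matrix.toLin'_mul, Matrix.toLin'_mul, exteriorPower.map_comp, exteriorPower.map_comp,
      LinearMap.comp_apply, LinearMap.comp_apply, hinv, hu.map_eq, map_smul, hc, map_smul,
      LinearMap.smul_apply] at h1
    calc _ = (c⁻¹ * d : Rˣ).val • ((c.val • topPairing R (C.r (k + 2)) (C.r (k + 1))
        (exteriorPower.map _ (Matrix.toLin' ((P (k + 1))⁻¹ : GL (Fin (C.dim (k + 1))) R).val)
        (u (k + 1))) (exteriorPower.map _
          (Matrix.toLin' ((P (k + 1))⁻¹ : GL (Fin (C.dim (k + 1))) R).val) v)) • u' k) := by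
          rw [h2, smul_smul, smul_eq_mul, Units.val_mul]
          congr 1
          linear_combination (-d.val * topPairing R (C.r (k + 2)) (C.r (k + 1))
            (exteriorPower.map _ (Matrix.toLin' ((P (k + 1))⁻¹ : GL (Fin (C.dim (k + 1))) R).val)
            (u (k + 1))) (exteriorPower.map _ (Matrix.toLin'
              ((P (k + 1))⁻¹ : GL (Fin (C.dim (k + 1))) R).val) v)) * c.inv_mul
      _ = _ := by
          rw [← h1]
          exact smul_comm (M := R) (N := R)
            (α := ⋀[R]^(C.r (k + 1)) (Fin (C.dim k) → R)) _ _ _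

end FreeComplex

/-! ## Ideals of minors and Fitting ideals -/

section Minors

variable {R : Type*} [CommRing R] {m n o : Type*}

/-- The ideal generated by the minors of order `p`, for arbitrary index types. -/
def minorIdeal (p : ℕ) (A : Matrix m n R) : Ideal R :=
  Ideal.span {d | ∃ (f : Fin p → m) (g : Fin p → n), d = (A.submatrix f g).det}

theorem detIdeal_eq_minorIdeal {a b : ℕ} (p : ℕ) (A : Matrix (Fin a) (Fin b) R) :
    detIdeal p A = minorIdeal p A := rfl

theorem det_mem_minorIdeal {p : ℕ} (A : Matrix m n R) (f : Fin p → m) (g : Fin p → n) :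
    (A.submatrix f g).det ∈ minorIdeal p A :=
  Ideal.subset_span ⟨f, g, rfl⟩

theorem minorIdeal_submatrix_le {m' n' : Type*} (p : ℕ) (A : Matrix m n R) (e : m' → m)
    (e' : n' → n) : minorIdeal p (A.submatrix e e') ≤ minorIdeal p A := by
  rw [minorIdeal, Ideal.span_le]
  rintro _ ⟨f, g, rfl⟩
  exact det_mem_minorIdeal A (e ∘ f) (e' ∘ g)

theorem minorIdeal_submatrix_equiv {m' n' : Type*} (p : ℕ) (A : Matrix m n R) (e : m' ≃ m)
    (e' : n' ≃ n) : minorIdeal p (A.submatrix e e') = minorIdeal p A := by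
  refine le_antisymm (minorIdeal_submatrix_le p A e e') ?_
  have := minorIdeal_submatrix_le p (A.submatrix e e') e.symm e'.symm
  simpa using this

theorem minorIdeal_zero (A : Matrix m n R) : minorIdeal 0 A = ⊤ :=
  (Ideal.eq_top_iff_one _).mpr
    (Ideal.subset_span ⟨Fin.elim0, Fin.elim0, (Matrix.det_isEmpty).symm⟩)

theorem extMatrix_mul {a b c : ℕ} (p : ℕ) (A : Matrix (Fin a) (Fin b) R)
    (B : Matrix (Fin b) (Fin c) R) : extMatrix p (A * B) = extMatrix p A * extMatrix p B := by
  classical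
  rw [extMatrix, Matrix.toLin'_mul, exteriorPower.map_comp,
    LinearMap.toMatrix_comp _ (natBasis R b p)]
  rfl

theorem detIdeal_mul_le {a b c : ℕ} (p : ℕ) (A : Matrix (Fin a) (Fin b) R)
    (B : Matrix (Fin b) (Fin c) R) :
    detIdeal p (A * B) ≤ detIdeal p A ∧ detIdeal p (A * B) ≤ detIdeal p B := by
  simp only [detIdeal_eq_span_extMatrix]
  constructor
  all_goals
    rw [Ideal.span_le]
    rintro _ ⟨I, J, rfl⟩
    rw [extMatrix_mul, Matrix.mul_apply]
    refine Ideal.sum_mem _ fun K _ => ?_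
  · exact Ideal.mul_mem_right _ _ (Ideal.subset_span ⟨_, _, rfl⟩)
  · exact Ideal.mul_mem_left _ _ (Ideal.subset_span ⟨_, _, rfl⟩)

theorem minorIdeal_mul_le [Fintype m] [Fintype n] [Fintype o] (p : ℕ) (A : Matrix m n R)
    (B : Matrix n o R) :
    minorIdeal p (A * B) ≤ minorIdeal p A ∧ minorIdeal p (A * B) ≤ minorIdeal p B := by
  have h := detIdeal_mul_le p
    (A.submatrix (Fintype.equivFin m).symm (Fintype.equivFin n).symm)
    (B.submatrix (Fintype.equivFin n).symm (Fintype.equivFin o).symm)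
  simpa only [Matrix.submatrix_mul_equiv, detIdeal_eq_minorIdeal, minorIdeal_submatrix_equiv] using h

theorem minorIdeal_succ_le (p : ℕ) (A : Matrix m n R) :
    minorIdeal (p + 1) A ≤ minorIdeal p A := by
  rw [minorIdeal, Ideal.span_le]
  rintro _ ⟨f, g, rfl⟩
  rw [Matrix.det_succ_row_zero]
  refine Ideal.sum_mem _ fun j _ => Ideal.mul_mem_left _ _ ?_
  exact det_mem_minorIdeal A (f ∘ Fin.succ) (g ∘ j.succAbove)

theorem exists_eq_inl_comp {p : ℕ} {f : Fin p → m ⊕ Fin 1} (h : ∀ i, f i ≠ Sum.inr 0) :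
    ∃ f' : Fin p → m, f = Sum.inl ∘ f' := by
  have : ∀ i, ∃ x, f i = Sum.inl x := fun i => by
    rcases hi : f i with x | x
    · exact ⟨x, rfl⟩
    · exact absurd (hi.trans (by rw [Subsingleton.elim x 0])) (h i)
  choose f' hf' using this
  exact ⟨f', funext hf'⟩

/-- A minor using the new row is expanded along it, leaving a minor of `A` of order one less or
zero. One avoiding the new row is zero or a larger minor of `A`. For `q = 0` the truncated
subtraction is harmless, both sides being `⊤`. -/
theorem minorIdeal_fromBlocks_one_one (q : ℕ) (A : Matrix m n R) :
    minorIdeal q (Matrix.fromBlocks A 0 0 (1 : Matrix (Fin 1) (Fin 1) R)) =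
      minorIdeal (q - 1) A := by
  classical
  rcases q with - | p
  · rw [minorIdeal_zero, Nat.zero_sub, minorIdeal_zero]
  rw [Nat.add_sub_cancel]
  set B := Matrix.fromBlocks A 0 0 (1 : Matrix (Fin 1) (Fin 1) R) with hB
  refine le_antisymm ?_ ?_
  · rw [minorIdeal, Ideal.span_le]
    rintro _ ⟨f, g, rfl⟩
    rw [SetLike.mem_coe]
    by_cases hf : Function.Injective f
    swap
    · obtain ⟨i, j, hij, hne⟩ := Function.not_injective_iff.mp hf
      rw [Matrix.det_zero_of_row_eq hne (by ext l; simp [hij])]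
      exact Ideal.zero_mem _
    by_cases hg : Function.Injective g
    swap
    · obtain ⟨i, j, hij, hne⟩ := Function.not_injective_iff.mp hg
      rw [Matrix.det_zero_of_column_eq hne (by intro l; simp [hij])]
      exact Ideal.zero_mem _
    by_cases hf0 : ∃ i, f i = Sum.inr 0
    · obtain ⟨i, hi⟩ := hf0
      rw [Matrix.det_succ_row _ i]
      refine Ideal.sum_mem _ fun j _ => ?_
      by_cases hj : g j = Sum.inr 0
      · refine Ideal.mul_mem_left _ _ ?_
        obtain ⟨f', hf'⟩ := exists_eq_inl_comp (f := f ∘ i.succAbove) fun l hl =>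
          i.succAbove_ne l (hf (hl.trans hi.symm))
        obtain ⟨g', hg'⟩ := exists_eq_inl_comp (f := g ∘ j.succAbove) fun l hl =>
          j.succAbove_ne l (hg (hl.trans hj.symm))
        rw [Matrix.submatrix_submatrix, hf', hg']
        exact det_mem_minorIdeal A f' g'
      · have h0 : (B.submatrix f g) i j = 0 := by
          rw [Matrix.submatrix_apply, hi, hB]
          rcases hgj : g j with x | x
          · rfl
          · exact absurd (hgj.trans (by rw [Subsingleton.elim x 0])) hj
        rw [h0, mul_zero, zero_mul]
        exact Ideal.zero_mem _
    · push Not at hf0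
      obtain ⟨f', rfl⟩ := exists_eq_inl_comp hf0
      by_cases hg0 : ∃ j, g j = Sum.inr 0
      · obtain ⟨j, hj⟩ := hg0
        rw [Matrix.det_eq_zero_of_column_eq_zero j fun i => by
          rw [Matrix.submatrix_apply, hj]; rfl]
        exact Ideal.zero_mem _
      · push Not at hg0
        obtain ⟨g', rfl⟩ := exists_eq_inl_comp hg0
        exact minorIdeal_succ_le p A (det_mem_minorIdeal A f' g')
  · rw [minorIdeal, Ideal.span_le]
    rintro _ ⟨f, g, rfl⟩
    have : (A.submatrix f g).det = (B.submatrix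
        ((Sum.map f id) ∘ finSumFinEquiv.symm) ((Sum.map g id) ∘ finSumFinEquiv.symm) :
          Matrix (Fin (p + 1)) (Fin (p + 1)) R).det := by
      rw [← Matrix.submatrix_submatrix, Matrix.det_submatrix_equiv_self]
      have hb : B.submatrix (Sum.map f id) (Sum.map g id) =
          Matrix.fromBlocks (A.submatrix f g) 0 0 1 := by
        ext (i | i) (j | j) <;> rfl
      rw [hb, Matrix.det_fromBlocks_zero₁₂, Matrix.det_one, mul_one]
    rw [this]
    exact det_mem_minorIdeal B _ _

theorem minorIdeal_fromBlocks_one (q s : ℕ) (A : Matrix m n R) :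
    minorIdeal q (Matrix.fromBlocks A 0 0 (1 : Matrix (Fin s) (Fin s) R)) =
      minorIdeal (q - s) A := by
  induction s generalizing q with
  | zero =>
    rw [Nat.sub_zero, ← minorIdeal_submatrix_equiv q _ (Equiv.sumEmpty m (Fin 0)).symm
      (Equiv.sumEmpty n (Fin 0)).symm]
    rfl
  | succ s ih =>
    rw [show q - (s + 1) = q - 1 - s by omega, ← ih, ← minorIdeal_fromBlocks_one_one,
      ← minorIdeal_submatrix_equiv q _ ((Equiv.sumAssoc m (Fin s) (Fin 1)).trans
        ((Equiv.refl m).sumCongr finSumFinEquiv))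
        ((Equiv.sumAssoc n (Fin s) (Fin 1)).trans ((Equiv.refl n).sumCongr finSumFinEquiv))]
    congr 1
    ext ((i | i) | i) ((j | j) | j) <;>
      simp [Matrix.one_apply, Fin.ext_iff] <;> omega

/-- Comparison of two presentations of isomorphic modules. -/
theorem detIdeal_le_of_equiv {n l n' l' : ℕ} (A : Matrix (Fin n) (Fin l) R)
    (B : Matrix (Fin n') (Fin l') R)
    (e : ((Fin n → R) ⧸ LinearMap.range A.mulVecLin) ≃ₗ[R]
      ((Fin n' → R) ⧸ LinearMap.range B.mulVecLin)) (k : ℕ) :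
    detIdeal (n - k) A ≤ detIdeal (n' - k) B := by
  classical
  let π := (LinearMap.range A.mulVecLin).mkQ
  let π' := (LinearMap.range B.mulVecLin).mkQ
  obtain ⟨Φ, hΦ⟩ : ∃ Φ : (Fin n → R) →ₗ[R] (Fin n' → R), π' ∘ₗ Φ = e.toLinearMap ∘ₗ π :=
    Module.projective_lifting_property π' _ (Submodule.mkQ_surjective _)
  obtain ⟨Ψ, hΨ⟩ : ∃ Ψ : (Fin n' → R) →ₗ[R] (Fin n → R), (e.toLinearMap ∘ₗ π) ∘ₗ Ψ = π' :=
    Module.projective_lifting_property _ _ (e.surjective.comp (Submodule.mkQ_surjective _))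
  have hrange : ∀ x y, e (π x) + π' y = 0 → ∃ z, y = B.mulVec z - Φ x := fun x y hxy => by
    have h1 : π' (y + Φ x) = 0 := by
      rw [map_add, add_comm, ← hxy]
      congr 1
      exact LinearMap.congr_fun hΦ x
    obtain ⟨z, hz⟩ := (Submodule.Quotient.mk_eq_zero _).mp h1
    exact ⟨z, eq_sub_of_add_eq hz.symm⟩
  choose z₁ hz₁ using fun j : Fin l => hrange (A.mulVec (Pi.single j 1)) 0 (by
    have : π (A.mulVec (Pi.single j 1)) = 0 := (Submodule.Quotient.mk_eq_zero _).mpr ⟨_, rfl⟩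
    rw [this, map_zero, map_zero, add_zero])
  choose z₂ hz₂ using fun j : Fin n' => hrange (-Ψ (Pi.single j 1)) (Pi.single j 1) (by
    have : e (π (Ψ (Pi.single j 1))) = π' (Pi.single j 1) := LinearMap.congr_fun hΨ _
    rw [map_neg, map_neg, this, neg_add_cancel])
  -- Take the generators of both presentations together. All relations between them come from the
  -- pairs `(x, -Φ x)` and `(0, B z)`; in particular the columns of the last factor's target, `(A
  -- e_j, 0)` and `(-Ψ e_j, e_j)`, do. Thus `A ⊕ 1` factors through `1 ⊕ B`, and Cauchy–Binet
  -- compares their minors.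
  have hfac : Matrix.fromBlocks A 0 0 (1 : Matrix (Fin n') (Fin n') R) =
      Matrix.fromBlocks (1 : Matrix (Fin n) (Fin n) R) (LinearMap.toMatrix' Ψ) 0
        (1 : Matrix (Fin n') (Fin n') R) *
      (Matrix.fromBlocks (1 : Matrix (Fin n) (Fin n) R) 0 (-LinearMap.toMatrix' Φ)
        (1 : Matrix (Fin n') (Fin n') R) * Matrix.fromBlocks (1 : Matrix (Fin n) (Fin n) R) 0 0 B *
      Matrix.fromBlocks A (-LinearMap.toMatrix' Ψ) (Matrix.of fun i j => z₁ j i)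
        (Matrix.of fun i j => z₂ j i)) := by
    have e1 : B * (Matrix.of fun i j => z₁ j i) = LinearMap.toMatrix' Φ * A := by
      ext i j
      have := congrFun (hz₁ j) i
      rw [Pi.sub_apply, Pi.zero_apply, eq_comm, sub_eq_zero] at this
      rw [show (B * Matrix.of fun i j => z₁ j i) i j = B.mulVec (z₁ j) i from rfl, this,
        ← LinearMap.toMatrix'_mulVec, Matrix.mulVec_mulVec]
      simp
    have e2 : B * (Matrix.of fun i j => z₂ j i) + LinearMap.toMatrix' Φ * LinearMap.toMatrix' Ψ
        = 1 := by
      ext i j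
      have := congrFun (hz₂ j) i
      rw [map_neg, sub_neg_eq_add, Pi.add_apply] at this
      rw [Matrix.add_apply,
        show (B * Matrix.of fun i j => z₂ j i) i j = B.mulVec (z₂ j) i from rfl,
        ← LinearMap.toMatrix'_comp, LinearMap.toMatrix'_apply, LinearMap.comp_apply,
        Matrix.one_apply, ← Pi.single_apply]
      exact this.symm
    simp only [Matrix.fromBlocks_multiply, Matrix.one_mul, Matrix.zero_mul, Matrix.mul_zero,
      add_zero, zero_add, Matrix.mul_one, Matrix.neg_mul, Matrix.mul_neg, neg_neg, e1]
    rw [neg_add_cancel, add_comm (LinearMap.toMatrix' Φ * _), e2]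
    simp
  have h := minorIdeal_fromBlocks_one (n + n' - k) n' A
  have h' := minorIdeal_fromBlocks_one (n + n' - k) n B
  rw [show n + n' - k - n' = n - k by omega] at h
  rw [show n + n' - k - n = n' - k by omega, ← minorIdeal_submatrix_equiv _ _
    (Equiv.sumComm _ _) (Equiv.sumComm _ _)] at h'
  rw [detIdeal_eq_minorIdeal, detIdeal_eq_minorIdeal, ← h, ← h', hfac]
  refine (minorIdeal_mul_le _ _ _).2.trans ((minorIdeal_mul_le _ _ _).1.trans
    ((minorIdeal_mul_le _ _ _).2.trans (le_of_eq ?_)))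
  congr 1
  ext (i | i) (j | j) <;> rfl

theorem fittingIdeal_coker {n l : ℕ} (A : Matrix (Fin n) (Fin l) R) (k : ℕ) :
    fittingIdeal R ((Fin n → R) ⧸ LinearMap.range A.mulVecLin) k = detIdeal (n - k) A := by
  refine le_antisymm ?_ ?_
  · refine iSup_le fun n' => iSup_le fun l' => iSup_le fun B => iSup_le fun ⟨e⟩ => ?_
    exact detIdeal_le_of_equiv B A e.symm k
  · exact le_iSup_of_le n (le_iSup_of_le l (le_iSup_of_le A (le_iSup_of_le ⟨LinearEquiv.refl _ _⟩
      le_rfl)))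

end Minors

/-! ### Invariance of the characteristic ideals -/

namespace FreeComplex

variable {R : Type*} [CommRing R]

theorem charIdeal_zero_eq_fittingIdeal (C : FreeComplex R) :
    C.charIdeal 0 = fittingIdeal R C.Coker (C.r 0) := by
  rw [fittingIdeal_coker, Nat.add_sub_cancel]
  rfl

theorem charIdeal_changeBasis (C : FreeComplex R) (P : ∀ k, GL (Fin (C.dim k)) R) (k : ℕ) :
    (C.changeBasis P).charIdeal k = C.charIdeal k := by
  refine le_antisymm ((detIdeal_mul_le _ _ _).1.trans (detIdeal_mul_le _ _ _).2) ?_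
  let A' : Matrix (Fin (C.dim k)) (Fin (C.dim (k + 1))) R :=
    ((P k)⁻¹ : GL (Fin (C.dim k)) R).val * C.A k * (P (k + 1)).val
  have h : C.A k = (P k).val * (A' * ((P (k + 1))⁻¹ : GL (Fin (C.dim (k + 1))) R).val) := by
    have h1 : (P k).val * ((P k)⁻¹ : GL (Fin (C.dim k)) R).val = 1 := by
      rw [← Units.val_mul, mul_inv_cancel, Units.val_one]
    have h2 : (P (k + 1)).val * ((P (k + 1))⁻¹ : GL (Fin (C.dim (k + 1))) R).val = 1 := by
      rw [← Units.val_mul, mul_inv_cancel, Units.val_one]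
    rw [Matrix.mul_assoc _ (P (k + 1)).val, h2, Matrix.mul_one, ← Matrix.mul_assoc, h1,
      Matrix.one_mul]
  have h3 : detIdeal (C.r (k + 1)) (C.A k) ≤ detIdeal (C.r (k + 1)) A' := by
    conv_lhs => rw [h]
    exact (detIdeal_mul_le _ _ _).2.trans (detIdeal_mul_le _ _ _).1
  exact h3

theorem detIdeal_zero_extension {a b a' b' p p' : ℕ} (hp : p' = p) (ha : a ≤ a') (hb : b ≤ b')
    (A : Matrix (Fin a) (Fin b) R) (A' : Matrix (Fin a') (Fin b') R)
    (hA : ∀ i j, A' i j = if h : i.val < a ∧ j.val < b then A ⟨i, h.1⟩ ⟨j, h.2⟩ else 0) :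
    detIdeal p' A' = detIdeal p A := by
  subst hp
  refine le_antisymm ?_ ?_
  · rw [detIdeal, Ideal.span_le]
    rintro _ ⟨f, g, rfl⟩
    by_cases hf : ∀ i, (f i).val < a
    · by_cases hg : ∀ i, (g i).val < b
      · refine Ideal.subset_span ⟨fun i => ⟨f i, hf i⟩, fun i => ⟨g i, hg i⟩, ?_⟩
        congr 1
        ext i j
        simp only [Matrix.submatrix_apply, hA]
        rw [dif_pos ⟨hf i, hg j⟩]
      · push Not at hg
        obtain ⟨j, hj⟩ := hg
        rw [Matrix.det_eq_zero_of_column_eq_zero j fun i => by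
          rw [Matrix.submatrix_apply, hA, dif_neg (by omega)]]
        exact Ideal.zero_mem _
    · push Not at hf
      obtain ⟨i, hi⟩ := hf
      rw [Matrix.det_eq_zero_of_row_eq_zero i fun j => by
        rw [Matrix.submatrix_apply, hA, dif_neg (by omega)]]
      exact Ideal.zero_mem _
  · have : A = A'.submatrix (Fin.castLE ha) (Fin.castLE hb) := by
      ext i j
      rw [Matrix.submatrix_apply, hA, dif_pos ⟨i.2, j.2⟩]
      rfl
    rw [this]
    exact minorIdeal_submatrix_le _ A' _ _

theorem detIdeal_identity_extension {a b a' b' p p' s : ℕ} (hp : p' = p + s) (ha : a' = a + s)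
    (hb : b' = b + s) (A : Matrix (Fin a) (Fin b) R) (A' : Matrix (Fin a') (Fin b') R)
    (hA : ∀ i j, A' i j = if h : i.val < a ∧ j.val < b then A ⟨i, h.1⟩ ⟨j, h.2⟩ else
      if a ≤ i.val ∧ b ≤ j.val ∧ i.val - a = j.val - b then 1 else 0) :
    detIdeal p' A' = detIdeal p A := by
  subst hp ha hb
  have h := minorIdeal_fromBlocks_one (p + s) s A
  rw [Nat.add_sub_cancel] at h
  rw [detIdeal_eq_minorIdeal p, ← h, detIdeal_eq_minorIdeal,
    ← minorIdeal_submatrix_equiv _ _ finSumFinEquiv finSumFinEquiv]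
  congr 1
  ext (i | i) (j | j)
  · rw [Matrix.submatrix_apply, hA, dif_pos ⟨by simp, by simp⟩]
    rfl
  · rw [Matrix.submatrix_apply, hA, dif_neg (by simp), if_neg (by simp)]
    rfl
  · rw [Matrix.submatrix_apply, hA, dif_neg (by simp), if_neg (by simp)]
    rfl
  · rw [Matrix.submatrix_apply, hA, dif_neg (by simp)]
    simp [Matrix.one_apply, Fin.ext_iff]

theorem modRank_of_ne (C : FreeComplex R) {k s j : ℕ} (h : j ≠ k + 1) :
    C.modRank k s j = C.r j := Function.update_of_ne h _ _

theorem modRank_succ (C : FreeComplex R) (k s : ℕ) :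
    C.modRank k s (k + 1) = C.r (k + 1) + s := Function.update_self _ _ _

theorem le_modRank (C : FreeComplex R) (k s j : ℕ) : C.r j ≤ C.modRank k s j := by
  by_cases h : j = k + 1
  · rw [h, modRank_succ]
    exact Nat.le_add_right _ _
  · rw [modRank_of_ne C h]

theorem charIdeal_elemMod (C : FreeComplex R) (k s j : ℕ) :
    (C.elemMod k s).charIdeal j = C.charIdeal j := by
  by_cases h : j = k
  · subst h
    refine detIdeal_identity_extension (s := s) (C.modRank_succ j s) ?_ ?_ (C.A j)
      (C.modMatrix j s j) fun p q => ?_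
    · rw [modRank_succ, modRank_of_ne C (by omega)]; omega
    · rw [modRank_succ, modRank_of_ne C (by omega)]; omega
    · simp only [modMatrix, Matrix.of_apply, true_and]
  · refine detIdeal_zero_extension (C.modRank_of_ne (by omega))
      (Nat.add_le_add (C.le_modRank k s _) (C.le_modRank k s _))
      (Nat.add_le_add (C.le_modRank k s _) (C.le_modRank k s _)) (C.A j)
      (C.modMatrix k s j) fun p q => ?_
    simp only [modMatrix, Matrix.of_apply, h, false_and, if_false]

end FreeComplex

/-! ## Exterior powers under the addition of free summands -/

section Extend

variable {R : Type*} [CommRing R]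

/-- Extension of vectors by zero. -/
def padHom (R : Type*) [CommRing R] (n n' : ℕ) : (Fin n → R) →ₗ[R] (Fin n' → R) where
  toFun x j := if h : j.val < n then x ⟨j, h⟩ else 0
  map_add' x y := by ext j; by_cases h : j.val < n <;> simp [h]
  map_smul' r x := by ext j; by_cases h : j.val < n <;> simp [h]

theorem padHom_apply {n n' : ℕ} (x : Fin n → R) (j : Fin n') :
    padHom R n n' x j = if h : j.val < n then x ⟨j, h⟩ else 0 := rfl

/-- The basis vectors in the positions `o, o + 1, …, o + s - 1`. -/
def blockVec (R : Type*) [CommRing R] (n' o s : ℕ) (i : Fin s) : Fin n' → R :=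
  fun x => if x.val = o + i.val then 1 else 0

/-- Extension by zero followed by the exterior product with a block of basis vectors. -/
noncomputable def extendHom (R : Type*) [CommRing R] (n n' p o s : ℕ) :
    ⋀[R]^p (Fin n → R) →ₗ[R] ⋀[R]^(p + s) (Fin n' → R) :=
  (wedgeHom R (Fin n' → R) p s).flip (exteriorPower.ιMulti R s (blockVec R n' o s)) ∘ₗ
    exteriorPower.map p (padHom R n n')

theorem extendHom_ιMulti {n n' p o s : ℕ} (a : Fin p → Fin n → R) :
    extendHom R n n' p o s (exteriorPower.ιMulti R p a) =
      exteriorPower.ιMulti R (p + s) (Fin.append (padHom R n n' ∘ a) (blockVec R n' o s)) := by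
  rw [extendHom, LinearMap.comp_apply, exteriorPower.map_apply_ιMulti]
  exact wedge_ιMulti _ _

/-- Regrouping the rows as old vectors, first new block, second new block gives a block diagonal
matrix with an identity block; `d` is the sign of that permutation. -/
theorem det_append_extend (p q s t : ℕ) :
    ∃ d : Rˣ, ∀ (a : Fin p → Fin (p + q) → R) (b : Fin q → Fin (p + q) → R),
      (Matrix.of (Fin.append
        (Fin.append (padHom R (p + q) (p + s + (q + t)) ∘ a)
          (blockVec R (p + s + (q + t)) (p + q) s))
        (Fin.append (padHom R (p + q) (p + s + (q + t)) ∘ b)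
          (blockVec R (p + s + (q + t)) (p + q + s) t)))).det =
        d * (Matrix.of (Fin.append a b)).det := by
  let er : Fin (p + q) ⊕ (Fin s ⊕ Fin t) ≃ Fin (p + s + (q + t)) :=
    ((finSumFinEquiv.symm.sumCongr (Equiv.refl _)).trans (Equiv.sumSumSumComm _ _ _ _)).trans
      ((finSumFinEquiv.sumCongr finSumFinEquiv).trans finSumFinEquiv)
  let ec : Fin (p + q) ⊕ (Fin s ⊕ Fin t) ≃ Fin (p + s + (q + t)) :=
    (((Equiv.refl _).sumCongr finSumFinEquiv).trans finSumFinEquiv).trans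
      (finCongr (by omega))
  let σ : Equiv.Perm (Fin (p + q) ⊕ (Fin s ⊕ Fin t)) := er.trans ec.symm
  refine ⟨Units.map (Int.castRingHom R).toMonoidHom (Equiv.Perm.sign σ), fun a b => ?_⟩
  have hc1 : ∀ j, (ec (Sum.inl j)).val = j.val := fun j => by simp [ec]
  have hc2 : ∀ j, (ec (Sum.inr (Sum.inl j))).val = p + q + j.val := fun j => by simp [ec]
  have hc3 : ∀ j, (ec (Sum.inr (Sum.inr j))).val = p + q + s + j.val := fun j => by
    simp [ec, add_assoc]
  set M := Matrix.of (Fin.append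
        (Fin.append (padHom R (p + q) (p + s + (q + t)) ∘ a)
          (blockVec R (p + s + (q + t)) (p + q) s))
        (Fin.append (padHom R (p + q) (p + s + (q + t)) ∘ b)
          (blockVec R (p + s + (q + t)) (p + q + s) t))) with hM
  have hblock : M.submatrix er ec = Matrix.fromBlocks (Matrix.of (Fin.append a b)) 0 0 1 := by
    have hpad : ∀ (x : Fin (p + q) → R) j,
        padHom R (p + q) (p + s + (q + t)) x (ec (Sum.inl j)) = x j := fun x j => by
      rw [padHom_apply, dif_pos (by rw [hc1]; exact j.2)]
      exact congrArg x (Fin.ext (hc1 j))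
    have hpad' : ∀ (x : Fin (p + q) → R) j,
        padHom R (p + q) (p + s + (q + t)) x (ec (Sum.inr j)) = 0 := fun x j => by
      rw [padHom_apply, dif_neg]
      rcases j with j | j
      · rw [hc2]; omega
      · rw [hc3]; omega
    ext (i | i | i) (j | j | j)
    · induction i using Fin.addCases <;> simp [hM, er, hpad]
    · induction i using Fin.addCases <;> simp [hM, er, hpad']
    · induction i using Fin.addCases <;> simp [hM, er, hpad']
    · have := j.2
      simp [hM, er, blockVec, hc1]
      omega
    · simp [hM, er, blockVec, hc2, Matrix.one_apply, Fin.ext_iff, eq_comm]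
    · simp [hM, er, blockVec, hc3]
      omega
    · have := j.2
      simp [hM, er, blockVec, hc1]
      omega
    · have := j.2
      simp [hM, er, blockVec, hc2]
      omega
    · simp [hM, er, blockVec, hc3, Matrix.one_apply, Fin.ext_iff, eq_comm]
  have h1 : M.submatrix er ec = (M.submatrix ec ec).submatrix σ id := by
    ext i j
    simp [σ]
  have h2 : M.det = (M.submatrix ec ec).det := (Matrix.det_submatrix_equiv_self _ _).symm
  have h3 := Matrix.det_permute σ (M.submatrix ec ec)
  rw [← h1, hblock, Matrix.det_fromBlocks_zero₁₂, Matrix.det_one, mul_one] at h3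
  have h4 : ((Equiv.Perm.sign σ : ℤ) : R) * ((Equiv.Perm.sign σ : ℤ) : R) = 1 := by
    rw [← Int.cast_mul, ← Units.val_mul, Int.units_mul_self, Units.val_one, Int.cast_one]
  rw [h3, h2]
  change _ = ((Equiv.Perm.sign σ : ℤ) : R) * _
  rw [← mul_assoc, h4, one_mul]

theorem topPairing_extendHom (p q s t : ℕ) :
    ∃ d : Rˣ, ∀ (x : ⋀[R]^p (Fin (p + q) → R)) (y : ⋀[R]^q (Fin (p + q) → R)),
      topPairing R (p + s) (q + t)
        (extendHom R (p + q) (p + s + (q + t)) p (p + q) s x)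
        (extendHom R (p + q) (p + s + (q + t)) q (p + q + s) t y) =
      d * topPairing R p q x y := by
  obtain ⟨d, hd⟩ := det_append_extend (R := R) p q s t
  refine ⟨d, fun x y => ?_⟩
  induction x using exteriorPower.induction_on with
  | ι a =>
    induction y using exteriorPower.induction_on with
    | ι b =>
      rw [extendHom_ιMulti, extendHom_ιMulti, topPairing_ιMulti, topPairing_ιMulti, hd]
    | zero => simp
    | add y z hy hz => simp only [map_add, mul_add, hy, hz]
    | smul r y hy => simp only [map_smul, smul_eq_mul, hy]; ring
  | zero => simp
  | add y z hy hz => simp only [map_add, LinearMap.add_apply, mul_add, hy, hz]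
  | smul r y hy => simp only [map_smul, LinearMap.smul_apply, smul_eq_mul, hy]; ring

theorem map_extendHom {n m n' m' p o o' s : ℕ} (f : (Fin n → R) →ₗ[R] (Fin m → R))
    (f' : (Fin n' → R) →ₗ[R] (Fin m' → R))
    (h : ∀ x, f' (padHom R n n' x) = padHom R m m' (f x))
    (h' : ∀ i, f' (blockVec R n' o s i) = blockVec R m' o' s i) (x : ⋀[R]^p (Fin n → R)) :
    exteriorPower.map (p + s) f' (extendHom R n n' p o s x) =
      extendHom R m m' p o' s (exteriorPower.map p f x) := by
  induction x using exteriorPower.induction_on with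
  | ι a =>
    rw [extendHom_ιMulti, exteriorPower.map_apply_ιMulti, exteriorPower.map_apply_ιMulti,
      extendHom_ιMulti]
    congr 1
    ext i : 1
    induction i using Fin.addCases <;> simp [h, h']
  | zero => simp
  | add y z hy hz => simp only [map_add, hy, hz]
  | smul r y hy => simp only [map_smul, hy]

theorem coordIdeal_units_smul {n p : ℕ} (c : Rˣ) (x : ⋀[R]^p (Fin n → R)) :
    coordIdeal (c.val • x) = coordIdeal x := by
  have h : ∀ (r : R) (y : ⋀[R]^p (Fin n → R)), coordIdeal (r • y) ≤ coordIdeal y :=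
    fun r y => coordIdeal_map_le (LinearMap.lsmul R _ r) y
  refine le_antisymm (h _ x) ?_
  have := h (c⁻¹).val (c.val • x)
  rwa [smul_smul, Units.inv_mul, one_smul] at this

/-- The nontrivial inclusion holds because wedging the test vectors with the remaining `t` basis
vectors recovers every value of the old pairing up to a unit. -/
theorem coordIdeal_extendHom {p q s t : ℕ} (x : ⋀[R]^p (Fin (p + q) → R)) :
    coordIdeal (extendHom R (p + q) (p + s + (q + t)) p (p + q) s x) = coordIdeal x := by
  refine le_antisymm (coordIdeal_map_le _ x) ?_
  obtain ⟨d, hd⟩ := topPairing_extendHom (R := R) p q s t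
  rw [coordIdeal_eq_range x]
  rintro _ ⟨y, rfl⟩
  have : topPairing R p q x y = (d⁻¹).val * (topPairing R (p + s) (q + t)
        (extendHom R (p + q) (p + s + (q + t)) p (p + q) s x)
        (extendHom R (p + q) (p + s + (q + t)) q (p + q + s) t y)) := by
    rw [hd, Units.inv_mul_cancel_left]
  rw [this]
  refine Ideal.mul_mem_left _ _ ?_
  rw [coordIdeal_eq_range]
  exact ⟨_, rfl⟩

/-- `u'` is, up to a unit, the exterior product of `u` with a block of `s` new basis vectors. -/
def IsExtension {n n' p p' : ℕ} (s : ℕ) (u : ⋀[R]^p (Fin n → R)) (u' : ⋀[R]^p' (Fin n' → R)) :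
    Prop :=
  ∃ c : Rˣ, (u' : ExteriorAlgebra R (Fin n' → R)) = c.val • (extendHom R n n' p n s u).val

theorem IsExtension.coordIdeal_eq {p q p' q' s t : ℕ} (hp : p' = p + s) (hq : q' = q + t)
    {u : ⋀[R]^p (Fin (p + q) → R)} {u' : ⋀[R]^p' (Fin (p' + q') → R)} (h : IsExtension s u u') :
    coordIdeal u' = coordIdeal u := by
  subst hp hq
  obtain ⟨c, hc⟩ := h
  have : u' = c.val • extendHom R (p + q) (p + s + (q + t)) p (p + q) s u := Subtype.ext hc
  rw [this, coordIdeal_units_smul, coordIdeal_extendHom]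

theorem isExtension_one {n n' p p' s : ℕ} (hp : p = 0) (hs : s = 0)
    {u : ⋀[R]^p (Fin n → R)} {u' : ⋀[R]^p' (Fin n' → R)}
    (hu : (u : ExteriorAlgebra R (Fin n → R)) = 1)
    (hu' : (u' : ExteriorAlgebra R (Fin n' → R)) = 1) : IsExtension s u u' := by
  subst hp hs
  obtain rfl : u = exteriorPower.ιMulti R 0 Fin.elim0 := Subtype.ext (by simp [hu])
  refine ⟨1, ?_⟩
  rw [hu', extendHom_ιMulti, Units.val_one, one_smul]
  exact (ExteriorAlgebra.ιMulti_zero_apply (R := R) (M := Fin n' → R) _).symm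

/-- The extension of factorization vectors descends along a differential of the form
`A ⊕ id ⊕ 0`. -/
theorem IsExtension.of_factorization {p q e p' q' e' s₁ s t : ℕ} (hp : p' = p + s₁)
    (hq : q' = q + s) (he : e' = e + t) {A : Matrix (Fin (q + e)) (Fin (p + q)) R}
    {A' : Matrix (Fin (q' + e')) (Fin (p' + q')) R}
    (hA : ∀ i j, A' i j = if h : i.val < q + e ∧ j.val < p + q then A ⟨i, h.1⟩ ⟨j, h.2⟩ else
      if ∃ x < s, i.val = q + e + x ∧ j.val = p + q + s₁ + x then 1 else 0)
    {w : ⋀[R]^p (Fin (p + q) → R)} {w' : ⋀[R]^p' (Fin (p' + q') → R)}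
    {u : ⋀[R]^q (Fin (q + e) → R)} {u' : ⋀[R]^q' (Fin (q' + e') → R)}
    (hu : ∀ v, exteriorPower.map q (Matrix.toLin' A) v = topPairing R p q w v • u)
    (hu' : ∀ v, exteriorPower.map q' (Matrix.toLin' A') v = topPairing R p' q' w' v • u')
    (hw : (coordIdeal w).IsFaithful) (h : IsExtension s₁ w w') : IsExtension s u u' := by
  subst hp hq he
  obtain ⟨c, hc⟩ := h
  obtain rfl : w' = c.val • extendHom R (p + q) (p + s₁ + (q + s)) p (p + q) s₁ w :=
    Subtype.ext hc
  obtain ⟨d, hd⟩ := topPairing_extendHom (R := R) p q s₁ s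
  have hpad : ∀ x, Matrix.toLin' A' (padHom R (p + q) (p + s₁ + (q + s)) x) =
      padHom R (q + e) (q + s + (e + t)) (Matrix.toLin' A x) := fun x => by
    have : Matrix.toLin' A' ∘ₗ padHom R (p + q) (p + s₁ + (q + s)) =
        padHom R (q + e) (q + s + (e + t)) ∘ₗ Matrix.toLin' A := by
      refine LinearMap.pi_ext' fun j => LinearMap.ext_ring ?_
      have hs : padHom R (p + q) (p + s₁ + (q + s)) (Pi.single j 1) =
          Pi.single (Fin.castLE (by omega) j) 1 := by
        ext l
        rw [padHom_apply]
        split_ifs with hl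
        · simp [Pi.single_apply, Fin.ext_iff]
        · rw [Pi.single_apply, if_neg]
          intro hlj
          exact hl (by rw [hlj]; exact j.2)
      ext i
      simp only [LinearMap.comp_apply, LinearMap.single_apply, hs, Matrix.toLin'_apply,
        Matrix.mulVec_single_one, padHom_apply, Matrix.col_apply, hA, Fin.val_castLE, j.2, and_true]
      split_ifs with h1 h2
      · rfl
      · obtain ⟨x, -, -, h3⟩ := h2
        have := j.2
        omega
      · rfl
    exact LinearMap.congr_fun this x
  have hblock : ∀ i, Matrix.toLin' A' (blockVec R (p + s₁ + (q + s)) (p + q + s₁) s i) =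
      blockVec R (q + s + (e + t)) (q + e) s i := fun i => by
    have hs : blockVec R (p + s₁ + (q + s)) (p + q + s₁) s i =
        Pi.single ⟨p + q + s₁ + i, by omega⟩ 1 := by
      ext l
      simp [blockVec, Pi.single_apply, Fin.ext_iff]
    ext l
    rw [hs, Matrix.toLin'_apply, Matrix.mulVec_single_one, Matrix.col_apply, hA,
      dif_neg (by simp only; omega), blockVec]
    refine if_congr ⟨?_, fun h => ⟨i, i.2, h, rfl⟩⟩ rfl rfl
    rintro ⟨x, -, h1, h2⟩
    simp only at h2
    omega
  refine ⟨c⁻¹ * d⁻¹, congrArg Subtype.val (?_ : u' = (c⁻¹ * d⁻¹ : Rˣ).val • extendHom R _ _ q _ s u)⟩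
  refine eq_of_forall_topPairing_smul_eq hw fun v => ?_
  -- The test vector is `v` wedged with the `s` basis vectors that `A'` carries identically to the
  -- new ones in the target. Its image is the extension of `⋀A v`, and its pairing with `w'` is `c *
  -- d` times that of `v` with `w`.
  have h1 := hu' (extendHom R (p + q) (p + s₁ + (q + s)) q (p + q + s₁) s v)
  rw [map_extendHom _ _ hpad hblock, hu, map_smul, map_smul, LinearMap.smul_apply, hd] at h1
  rw [smul_comm, h1, smul_smul, Units.val_mul, smul_eq_mul]
  congr 1
  linear_combination (-d.inv * d.val * topPairing R p q w v) * c.inv_mul -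
    topPairing R p q w v * d.inv_mul

end Extend

/-! ### Factorization ideals under elementary modifications -/

namespace FreeComplex

variable {R : Type*} [CommRing R] {C : FreeComplex R} {u : C.VectorSystem}

theorem IsFactorization.isExtension_elemMod (hC : C.IsCayley) (hu : C.IsFactorization u)
    (k s : ℕ) {u' : (C.elemMod k s).VectorSystem} (hu' : (C.elemMod k s).IsFactorization u')
    (j : ℕ) : IsExtension (if j = k then s else 0) (u j) (u' j) := by
  induction j using (C.elemMod k s).descending_induction with
  | top j hj =>
    have hr : ∀ i, j < i → C.r i = 0 := fun i hi =>
      Nat.le_zero.mp ((C.le_modRank k s i).trans_eq (hj i hi))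
    refine isExtension_one (hr _ (Nat.lt_succ_self j)) ?_ (hu.1 j hr) (hu'.1 j hj)
    -- Above the top degree of the modified complex all its ranks vanish, which for `j = k` forces
    -- `s = 0`.
    split_ifs with h
    · subst h
      have h1 := hj _ (Nat.lt_succ_self j)
      have h2 : (C.elemMod j s).r (j + 1) = C.r (j + 1) + s := C.modRank_succ j s
      exact (Nat.add_eq_zero_iff.mp (h2.symm.trans h1)).2
    · rfl
  | step j ih =>
    have hrank : ∀ i, C.modRank k s (i + 1) = C.r (i + 1) + if i = k then s else 0 := fun i => by
      split_ifs with h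
      · rw [h, modRank_succ]
      · rw [modRank_of_ne C (by omega), add_zero]
    obtain ⟨t, ht⟩ := Nat.exists_eq_add_of_le (C.le_modRank k s j)
    refine IsExtension.of_factorization (hrank (j + 1)) (hrank j) ht (A := C.A j)
      (A' := C.modMatrix k s j) (fun p q => ?_) (hu.map_eq j) (hu'.map_eq j)
      (hu.isFaithful_succ hC j) ih
    simp only [modMatrix, Matrix.of_apply]
    refine dite_congr rfl (fun _ => rfl) fun _ => if_congr ?_ rfl rfl
    by_cases h : j = k
    · subst h
      have hp := p.2
      have h1 := hrank j
      have h2 := C.modRank_of_ne (k := j) (s := s) (j := j) (by omega)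
      simp only [true_and, if_true, Nat.succ_ne_self, if_false, add_zero] at h1 ⊢
      constructor
      · rintro ⟨h3, h4, h5⟩
        refine ⟨p.val - C.dim j, ?_, ?_, ?_⟩ <;> simp only [dim] at * <;> omega
      · rintro ⟨x, hx, h3, h4⟩
        simp only [dim] at *
        omega
    · simp only [h, false_and, if_false, false_iff]
      rintro ⟨x, hx, -⟩
      exact absurd hx (Nat.not_lt_zero x)

theorem IsFactorization.factIdeal_elemMod (hC : C.IsCayley) (hu : C.IsFactorization u)
    (k s : ℕ) {u' : (C.elemMod k s).VectorSystem} (hu' : (C.elemMod k s).IsFactorization u')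
    (j : ℕ) : (C.elemMod k s).factIdeal u' j = C.factIdeal u j := by
  obtain ⟨t, ht⟩ := Nat.exists_eq_add_of_le (C.le_modRank k s j)
  refine (hu.isExtension_elemMod hC k s hu' j).coordIdeal_eq (t := t) ?_ ht
  change C.modRank k s (j + 1) = _
  split_ifs with h
  · rw [h, modRank_succ]
  · rw [modRank_of_ne C (by omega), add_zero]

end FreeComplex

/-! ## Strong gcds and MacRae invariants -/

section Gcd

variable {R : Type*} [CommRing R] {I J : Ideal R} {g : R}

theorem mem_nonZeroDivisors_of_isFaithful_span (h : (Ideal.span {g}).IsFaithful) :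
    g ∈ nonZeroDivisors R := by
  refine mem_nonZeroDivisors_iff_right.mpr fun x hx => h x fun b hb => ?_
  obtain ⟨c, rfl⟩ := Ideal.mem_span_singleton'.mp hb
  rw [mul_assoc, mul_comm g x, hx, mul_zero]

theorem Ideal.quotBy_mul_span_singleton (hg : g ∈ nonZeroDivisors R) :
    (J * Ideal.span {g}).quotBy g = J := by
  ext x
  change g * x ∈ J * Ideal.span {g} ↔ x ∈ J
  rw [Ideal.mem_mul_span_singleton]
  constructor
  · rintro ⟨z, hz, h⟩
    rw [mul_comm z g, mul_cancel_left_mem_nonZeroDivisors hg] at h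
    exact h ▸ hz
  · exact fun hx => ⟨x, hx, mul_comm _ _⟩

theorem isStrongGcd_mul_span_singleton (hI : (J * Ideal.span {g}).IsFaithful)
    (hJ : J.IsGradeTwo) : IsStrongGcd g (J * Ideal.span {g}) := by
  refine ⟨hI, fun b hb => ?_, fun y hy x h => hJ.dvd_of_forall_dvd_mul hy fun c hc => ?_⟩
  · obtain ⟨z, -, rfl⟩ := Ideal.mem_mul_span_singleton.mp hb
    exact dvd_mul_left _ _
  · have := h _ (Ideal.mem_mul_span_singleton.mpr ⟨c, hc, rfl⟩)
    rwa [mul_assoc, mul_comm g c]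

/-- For `b` in `I / e'`, the product `e' * b` lies in `I ⊆ ⟨e⟩`; the grade of `I / e'` then removes
`b`. By symmetry the two generators divide each other. -/
theorem IsMacRaeGenerator.dvd {e e' : R} (h : IsMacRaeGenerator I e)
    (h' : IsMacRaeGenerator I e') : e ∣ e' := by
  refine (depthGE_two_iff.mp h'.2.2).2.dvd_of_forall_dvd_mul h.1 fun b hb => ?_
  exact Ideal.mem_span_singleton.mp (h.2.1 hb)

theorem macRaeInvariant_eq {M : Type*} [AddCommGroup M] [Module R M] {e : R}
    (h : IsMacRaeGenerator (fittingIdeal R M 0) e) : macRaeInvariant R M = Ideal.span {e} := by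
  have hex : ∃ e : R, IsMacRaeGenerator (fittingIdeal R M 0) e := ⟨e, h⟩
  rw [macRaeInvariant, dif_pos hex]
  exact le_antisymm (Ideal.span_singleton_le_span_singleton.mpr (h.dvd hex.choose_spec))
    (Ideal.span_singleton_le_span_singleton.mpr (hex.choose_spec.dvd h))

/-- The factors are paired as `(0, 1), (2, 3), …`; an unpaired `b m` remains when `m` is even. Since
`charIdeal k` is `𝔇_{k+1}`, even `k` yields the characteristic ideals of odd index. -/
theorem prod_range_eq_prod_even {α : Type*} [CommMonoid α] {b d : ℕ → α}
    (h : ∀ k, d k = b (k + 1) * b k) (m : ℕ) :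
    ∏ k ∈ Finset.range (m + 1), b k =
      (∏ k ∈ Finset.range m with Even k, d k) * if Even m then b m else 1 := by
  induction m with
  | zero => simp
  | succ m ih =>
    rw [Finset.prod_range_succ, ih, Finset.range_add_one, Finset.filter_insert]
    by_cases hm : Even m
    · rw [if_pos hm, if_pos hm, if_neg (by simpa [Nat.even_add_one] using hm),
        Finset.prod_insert (by simp), h, mul_one]
      ac_rfl
    · rw [if_neg hm, if_neg hm, if_pos (by simpa [Nat.even_add_one] using hm), mul_one]

theorem prod_range_eq_prod_odd {α : Type*} [CommMonoid α] {b d : ℕ → α}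
    (h : ∀ k, d k = b (k + 1) * b k) (m : ℕ) :
    ∏ k ∈ Finset.range (m + 1), b k =
      b 0 * (∏ k ∈ Finset.range m with Odd k, d k) * if Odd m then b m else 1 := by
  induction m with
  | zero => simp
  | succ m ih =>
    rw [Finset.prod_range_succ, ih, Finset.range_add_one, Finset.filter_insert]
    by_cases hm : Odd m
    · rw [if_pos hm, if_pos hm, if_neg (by simpa [Nat.odd_add_one] using hm),
        Finset.prod_insert (by simp), h, mul_one]
      ac_rfl
    · rw [if_neg hm, if_neg hm, if_pos (by simpa [Nat.odd_add_one] using hm), mul_one]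

theorem coordIdeal_eq_top {n p : ℕ} (hp : p = 0) {x : ⋀[R]^p (Fin n → R)}
    (hx : (x : ExteriorAlgebra R (Fin n → R)) = 1) : coordIdeal x = ⊤ := by
  subst hp
  obtain rfl : x = exteriorPower.ιMulti R 0 Fin.elim0 := Subtype.ext (by simp [hx])
  refine (Ideal.eq_top_iff_one _).mpr (Ideal.subset_span ⟨⟨∅, rfl⟩, ?_⟩)
  rw [coords_ιMulti, Matrix.det_isEmpty]

theorem coords_map_of_eq {n p : ℕ} (hn : n = p) (f : (Fin n → R) →ₗ[R] (Fin n → R))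
    (x : ⋀[R]^p (Fin n → R)) (I : Set.powersetCard (Fin n) p) :
    coords (exteriorPower.map p f x) I = LinearMap.det f * coords x I := by
  subst hn
  have hI : I = ⟨Finset.univ, by simp⟩ :=
    Subtype.ext (Finset.eq_univ_of_card _ (by rw [Set.powersetCard.card_eq, Fintype.card_fin]))
  rw [hI]
  exact topForm_map f x

theorem coords_map_toLin' {a b p : ℕ} (A : Matrix (Fin a) (Fin b) R) (x : ⋀[R]^p (Fin b → R)) :
    coords (exteriorPower.map p (Matrix.toLin' A) x) = (extMatrix p A).mulVec (coords x) := by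
  classical
  exact (LinearMap.toMatrix_mulVec_repr (natBasis R b p) (natBasis R a p) _ x).symm

theorem isUnit_extMatrix {n : ℕ} (p : ℕ) (P : GL (Fin n) R) : IsUnit (extMatrix p P.val) := by
  classical
  have h1 : extMatrix p (1 : Matrix (Fin n) (Fin n) R) = 1 := by
    rw [extMatrix, Matrix.toLin'_one, exteriorPower.map_id, LinearMap.toMatrix_id]
  refine ⟨⟨extMatrix p P.val, extMatrix p (P⁻¹ : GL (Fin n) R).val, ?_, ?_⟩, rfl⟩ <;>
    rw [← extMatrix_mul, ← Units.val_mul]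
  · rw [mul_inv_cancel, Units.val_one, h1]
  · rw [inv_mul_cancel, Units.val_one, h1]

end Gcd

/-! ### Elementary equivalence and the generator of the ideal `𝔅₀` -/

namespace FreeComplex

variable {R : Type*} [CommRing R] {C : FreeComplex R} {u : C.VectorSystem}

theorem isCayley_congr {C' : FreeComplex R} (h : ∀ k, C'.charIdeal k = C.charIdeal k) :
    C.IsCayley ↔ C'.IsCayley := by
  simp only [IsCayley, h]

theorem IsFactorization.factIdeal_changeBasis (hC : C.IsCayley) (hu : C.IsFactorization u)
    (P : ∀ k, GL (Fin (C.dim k)) R) {u' : (C.changeBasis P).VectorSystem}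
    (hu' : (C.changeBasis P).IsFactorization u') (k : ℕ) :
    (C.changeBasis P).factIdeal u' k = C.factIdeal u k := by
  obtain ⟨c, hc⟩ := hu.changeBasis hC P hu' k
  change coordIdeal (R := R) (n := C.dim k) (p := C.r (k + 1)) (u' k) = coordIdeal (u k)
  rw [hc, coordIdeal_units_smul]
  refine le_antisymm (coordIdeal_map_le _ _) ?_
  have h := coordIdeal_map_le (exteriorPower.map (C.r (k + 1)) (Matrix.toLin' (P k).val))
    (exteriorPower.map (C.r (k + 1))
      (Matrix.toLin' ((P k)⁻¹ : GL (Fin (C.dim k)) R).val) (u k))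
  rwa [← LinearMap.comp_apply, ← exteriorPower.map_comp, toLin'_inv_comp,
    exteriorPower.map_id, LinearMap.id_apply] at h

/-- Equality of characteristic ideals is proved without the Cayley hypothesis, so that this
hypothesis can be carried along either direction of an elementary step. -/
theorem ElemEquiv.invariance {C' : FreeComplex R} (h : C.ElemEquiv C') :
    (∀ k, C'.charIdeal k = C.charIdeal k) ∧
    (C.IsCayley → ∀ u : C.VectorSystem, C.IsFactorization u →
      ∀ u' : C'.VectorSystem, C'.IsFactorization u' →
        ∀ k, C'.factIdeal u' k = C.factIdeal u k) := by
  induction h with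
  | changeBasis C P =>
    exact ⟨C.charIdeal_changeBasis P, fun hC u hu u' hu' => hu.factIdeal_changeBasis hC P hu'⟩
  | elemMod C k s =>
    exact ⟨C.charIdeal_elemMod k s, fun hC u hu u' hu' => hu.factIdeal_elemMod hC k s hu'⟩
  | refl C => exact ⟨fun _ => rfl, fun hC u hu u' hu' k => by rw [hu.unique hC hu']⟩
  | symm _ ih =>
    exact ⟨fun k => (ih.1 k).symm, fun hC u hu u' hu' k =>
      (ih.2 ((isCayley_congr ih.1).mpr hC) u' hu' u hu k).symm⟩
  | trans _ _ ih ih' =>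
    refine ⟨fun k => (ih'.1 k).trans (ih.1 k), fun hC u hu u' hu' k => ?_⟩
    have hC' := (isCayley_congr ih.1).mp hC
    -- The intermediate complex is Cayley, so it has factorization vectors through which the two
    -- ends are compared.
    obtain ⟨w, hw⟩ := exists_isFactorization hC'
    exact (ih'.2 hC' w hw u' hu' k).trans (ih.2 hC u hu w hw k)

theorem IsFactorization.factIdeal_eq_top (hu : C.IsFactorization u) {m : ℕ}
    (hm : ∀ k, m < k → C.r k = 0) : C.factIdeal u m = ⊤ :=
  coordIdeal_eq_top (hm _ (Nat.lt_succ_self m)) (hu.1 m hm)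

theorem coords_eq_cayleyDet (h : C.r 0 = 0) (I) : coords (u 0) I = C.cayleyDet h u := by
  rw [cayleyDet]
  congr 1
  exact Subtype.ext (Finset.eq_univ_of_card _
    (by rw [Set.powersetCard.card_eq, Fintype.card_fin, dim, h, add_zero]))

theorem factIdeal_zero_eq_span_cayleyDet (h : C.r 0 = 0) :
    C.factIdeal u 0 = Ideal.span {C.cayleyDet h u} := by
  rw [factIdeal, coordIdeal]
  congr 1
  ext x
  simp only [Set.mem_range, coords_eq_cayleyDet h, Set.mem_singleton_iff]
  exact ⟨fun ⟨_, hx⟩ => hx.symm, fun hx => ⟨⟨Finset.univ, by simp [h]⟩, hx.symm⟩⟩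

/-- The properties of a generator of `𝔅₀`. -/
theorem IsFactorization.of_factIdeal_zero_eq_span (hC : C.IsCayley) (hu : C.IsFactorization u)
    {g : R} (hg : C.factIdeal u 0 = Ideal.span {g}) :
    g ∈ nonZeroDivisors R ∧ C.charIdeal 0 ≤ Ideal.span {g} ∧ IsStrongGcd g (C.charIdeal 0) ∧
      DepthGE 2 ((C.charIdeal 0).quotBy g) := by
  have hreg : g ∈ nonZeroDivisors R := mem_nonZeroDivisors_of_isFaithful_span
    (hg ▸ (depthGE_one_iff.mp (hu.depthGE_one hC)).2)
  have hf := (depthGE_one_iff.mp hC.1).2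
  have h2 := hu.depthGE_two hC le_rfl
  have hchar := hu.charIdeal_eq 0
  rw [hg] at hchar
  rw [hchar] at hf ⊢
  refine ⟨hreg, Ideal.mul_le_right, isStrongGcd_mul_span_singleton hf (depthGE_two_iff.mp h2).2, ?_⟩
  rwa [Ideal.quotBy_mul_span_singleton hreg]

end FreeComplex

theorem mainTheorem1 {R : Type*} [CommRing R] (C : FreeComplex R) (hC : C.IsCayley) :
    (∃! u : C.VectorSystem, C.IsFactorization u) ∧
    ∀ u : C.VectorSystem, C.IsFactorization u →
      -- the factorization ideals
      (∀ k, C.charIdeal k = C.factIdeal u (k + 1) * C.factIdeal u k) ∧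
      DepthGE 1 (C.factIdeal u 0) ∧
      (∀ k, 1 ≤ k → DepthGE 2 (C.factIdeal u k)) ∧
      (∀ m, (∀ k, m < k → C.r k = 0) →
        (∏ k ∈ Finset.range (m + 1), C.factIdeal u k =
            C.factIdeal u 0 * ∏ k ∈ Finset.range m with Odd k, C.charIdeal k) ∧
        (∏ k ∈ Finset.range (m + 1), C.factIdeal u k =
            ∏ k ∈ Finset.range m with Even k, C.charIdeal k)) ∧
      -- the Cayley determinant
      (∀ h : C.r 0 = 0,
        C.factIdeal u 0 = Ideal.span {C.cayleyDet h u} ∧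
        (∀ I J, extMatrix (C.r 1) (C.A 0) I J =
          C.cayleyDet h u * coords (hodge (u 1)) J) ∧
        C.cayleyDet h u ∈ nonZeroDivisors R ∧
        C.charIdeal 0 = fittingIdeal R C.Coker 0 ∧
        IsStrongGcd (C.cayleyDet h u) (fittingIdeal R C.Coker 0) ∧
        DepthGE 2 ((C.charIdeal 0).quotBy (C.cayleyDet h u)) ∧
        IsMacRaeModule R C.Coker ∧
        macRaeInvariant R C.Coker = C.factIdeal u 0) ∧
      -- the case of positive Euler characteristic with a principal `𝔅₀`
      (0 < C.r 0 → ∀ g : R, C.factIdeal u 0 = Ideal.span {g} →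
        g ∈ nonZeroDivisors R ∧
        C.charIdeal 0 = fittingIdeal R C.Coker (C.r 0) ∧
        IsStrongGcd g (fittingIdeal R C.Coker (C.r 0)) ∧
        DepthGE 2 ((C.charIdeal 0).quotBy g)) ∧
      -- changes of bases
      (∀ P : ∀ k, GL (Fin (C.dim k)) R,
        (C.changeBasis P).IsCayley ∧
        (∀ k, (C.changeBasis P).charIdeal k = C.charIdeal k) ∧
        ∀ u' : (C.changeBasis P).VectorSystem, (C.changeBasis P).IsFactorization u' →
          (∀ k, (C.changeBasis P).factIdeal u' k = C.factIdeal u k) ∧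
          (∀ k, ∃ c : Rˣ,
            IsUnit (c.val • extMatrix (C.r (k + 1)) ((P k)⁻¹ : GL (Fin (C.dim k)) R).val) ∧
            coords (u' k) =
              Matrix.mulVec
                (c.val • extMatrix (C.r (k + 1)) ((P k)⁻¹ : GL (Fin (C.dim k)) R).val)
                (coords (u k))) ∧
          ∀ h : C.r 0 = 0, ∃ c : Rˣ,
            (C.changeBasis P).cayleyDet h u' = c.val * C.cayleyDet h u) ∧
      -- elementary modifications
      (∀ C' : FreeComplex R, C.ElemEquiv C' →
        C'.IsCayley ∧
        (∀ k, C'.charIdeal k = C.charIdeal k) ∧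
        ∀ u' : C'.VectorSystem, C'.IsFactorization u' →
          ∀ k, C'.factIdeal u' k = C.factIdeal u k) := by
  refine ⟨?_, fun u hu => ⟨hu.charIdeal_eq, hu.depthGE_one hC, fun k hk => hu.depthGE_two hC hk,
    fun m hm => ?_, fun h => ?_, fun _ g hg => ?_, fun P => ?_, fun C' hC' => ?_⟩⟩
  · obtain ⟨u, hu⟩ := FreeComplex.exists_isFactorization hC
    exact ⟨u, hu, fun u' hu' => hu'.unique hC hu⟩
  · have htop := hu.factIdeal_eq_top hm
    refine ⟨(prod_range_eq_prod_odd hu.charIdeal_eq m).trans ?_,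
      (prod_range_eq_prod_even hu.charIdeal_eq m).trans ?_⟩
    -- The unpaired factor, if any, is `𝔅_m = ⟨1⟩`.
    all_goals rw [htop, ← Ideal.one_eq_top, ite_self, mul_one]
  · have hg := FreeComplex.factIdeal_zero_eq_span_cayleyDet (u := u) h
    obtain ⟨h1, h2, h3, h4⟩ := hu.of_factIdeal_zero_eq_span hC hg
    have hfit : C.charIdeal 0 = fittingIdeal R C.Coker 0 :=
      C.charIdeal_zero_eq_fittingIdeal.trans (congrArg (fittingIdeal R C.Coker) h)
    have hmac : IsMacRaeGenerator (fittingIdeal R C.Coker 0) (C.cayleyDet h u) := by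
      rw [← hfit]
      exact ⟨h1, h2, h4⟩
    refine ⟨hg, fun I J => ?_, h1, hfit, hfit ▸ h3, h4, ⟨?_, _, hmac⟩, ?_⟩
    · rw [hu.2 0, Matrix.vecMulVec_apply, FreeComplex.coords_eq_cayleyDet h]
    · refine Module.finitePresentation_of_surjective (LinearMap.range (C.A 0).mulVecLin).mkQ
        (Submodule.mkQ_surjective _) ?_
      rw [Submodule.ker_mkQ, LinearMap.range_eq_map]
      exact Module.Finite.fg_top.map _
    · rw [macRaeInvariant_eq hmac, hg]
  · obtain ⟨h1, h2, h3, h4⟩ := hu.of_factIdeal_zero_eq_span hC hg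
    have hfit := C.charIdeal_zero_eq_fittingIdeal
    exact ⟨h1, hfit, hfit ▸ h3, h4⟩
  · have hchar := C.charIdeal_changeBasis P
    refine ⟨(FreeComplex.isCayley_congr hchar).mp hC, hchar, fun u' hu' =>
      ⟨hu.factIdeal_changeBasis hC P hu', fun k => ?_, fun h => ?_⟩⟩
    · obtain ⟨c, hc⟩ := hu.changeBasis hC P hu' k
      refine ⟨c, ?_, ?_⟩
      · exact (isUnit_extMatrix _ _).smul c
      · rw [Matrix.smul_mulVec, ← coords_map_toLin']
        refine (congrArg (coords (R := R) (n := C.dim k) (p := C.r (k + 1))) hc).trans ?_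
        ext I
        simp [coords]
    · obtain ⟨c, hc⟩ := hu.changeBasis hC P hu' 0
      let d := Matrix.GeneralLinearGroup.det (P 0)⁻¹
      refine ⟨c * d, ?_⟩
      have hd : d.val = LinearMap.det
          (Matrix.toLin' ((P 0)⁻¹ : GL (Fin (C.dim 0)) R).val) := by
        rw [LinearMap.det_toLin', Matrix.GeneralLinearGroup.val_det_apply]
      change coords (R := R) (n := C.dim 0) (p := C.r 1) (u' 0) ⟨Finset.univ, _⟩ = _
      -- For `r₀ = 0` the vector `u₀` lives in top degree, where `⋀P₀⁻¹` is multiplication by `det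
      -- P₀⁻¹`.
      rw [hc, Units.val_mul, mul_assoc, hd, FreeComplex.cayleyDet,
        ← coords_map_of_eq (by rw [FreeComplex.dim, h, add_zero])]
      simp [coords]
  · obtain ⟨h1, h2⟩ := hC'.invariance
    exact ⟨(FreeComplex.isCayley_congr h1).mp hC, h1, h2 hC u hu⟩
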